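/- Let $N\ge 1$ be an integer. The differential polynomials $L_k[u]$ are given by $L_0[u]=\tfrac12$ and the Lenard recursion $\frac{d}{dz}L_{k+1}[u]=\bigl(\frac{d^3}{dz^3}+4u\frac{d}{dz}+2u_z\bigr)L_k[u]$, the constants of integration being chosen so that $L_k[0]=0$ for $k\ge 1$. The $N$-th equation of the second Painlevé hierarchy is $$P_2^{(N)}[w,\alpha]:\quad \Bigl(\frac{d}{dz}+2w\Bigr)L_N[w'-w^2]-zw-\alpha=0 .$$ There is exactly one sequence $(Q_n^{(N)})_{n\ge 0}$ of monic polynomials in $\mathbb{C}[z]$ with $Q_0^{(N)}=1$, $Q_1^{(N)}=z$ such that for every $n\ge 1$ the rational function $w(z)=\frac{d}{dz}\ln\frac{Q_{n-1}^{(N)}(z)}{Q_n^{(N)}(z)}$ solves $P_2^{(N)}[w,n]$ (the generalized Yablonskii--Vorob'ev polynomials). Write $Q_n^{(N)}(z)=\sum_{k=0}^{p_n}A_{n,k}^{(N)}z^{p_n-k}$ with $p_n=\deg Q_n^{(N)}$. For every integer $l\ge 0$, the coefficient $A_{n,(2N+1)l}^{(N)}$ is a polynomial in $n$ of degree $2(N+1)l$: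 there is a polynomial $P\in\mathbb{C}[x]$ of degree $2(N+1)l$ with $A_{n,(2N+1)l}^{(N)}=P(n)$ for all $n\ge 0$ with $(2N+1)l\le p_n$. Moreover, $P(x)$ is divisible in $\mathbb{C}[x]$ by $x(x-1)\cdots(x-n_0+1)$, where $n_0=\Bigl\lceil\sqrt{\tfrac14+2(2N+1)l}-\tfrac12\Bigr\rceil$. -/

import Mathlib

open Polynomial

namespace PainleveII

/-- The derivative `d/dz` on the field `ℂ(z)` of rational functions. -/
noncomputable def ratDerivFun (f : RatFunc ℂ) : RatFunc ℂ :=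
  (algebraMap ℂ[X] (RatFunc ℂ) (derivative f.num) * algebraMap ℂ[X] (RatFunc ℂ) f.denom
    - algebraMap ℂ[X] (RatFunc ℂ) f.num * algebraMap ℂ[X] (RatFunc ℂ) (derivative f.denom))
    / algebraMap ℂ[X] (RatFunc ℂ) f.denom ^ 2

theorem quotient_rule_aux {K : Type*} [Field K] {a b a' b' p q p' q' : K} (hb : b ≠ 0)
    (hq : q ≠ 0) (h : a * q = p * b) (h' : a' * q + a * q' = p' * b + p * b') :
    (a' * b - a * b') / b ^ 2 = (p' * q - p * q') / q ^ 2 := by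
  rw [div_eq_div_iff (pow_ne_zero 2 hb) (pow_ne_zero 2 hq)]
  linear_combination (b * q) * h' - (q * b' + b * q') * h

/-- The quotient rule, for every representation of a rational function as a fraction. -/
theorem ratDerivFun_div (p q : ℂ[X]) (hq : q ≠ 0) (f : RatFunc ℂ)
    (hf : f = algebraMap ℂ[X] (RatFunc ℂ) p / algebraMap ℂ[X] (RatFunc ℂ) q) :
    ratDerivFun f =
      (algebraMap ℂ[X] (RatFunc ℂ) (derivative p) * algebraMap ℂ[X] (RatFunc ℂ) q
        - algebraMap ℂ[X] (RatFunc ℂ) p * algebraMap ℂ[X] (RatFunc ℂ) (derivative q))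
        / algebraMap ℂ[X] (RatFunc ℂ) q ^ 2 := by
  have hd' : algebraMap ℂ[X] (RatFunc ℂ) f.denom ≠ 0 :=
    RatFunc.algebraMap_ne_zero (RatFunc.denom_ne_zero f)
  have hq' : algebraMap ℂ[X] (RatFunc ℂ) q ≠ 0 := RatFunc.algebraMap_ne_zero hq
  have key : f.num * q = p * f.denom := by
    apply RatFunc.algebraMap_injective ℂ
    rw [map_mul, map_mul]
    have h1 := hf
    rw [← RatFunc.num_div_denom f] at h1
    rwa [div_eq_div_iff hd' hq'] at h1
  have key' := congrArg derivative key
  rw [derivative_mul, derivative_mul] at key'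
  refine quotient_rule_aux hd' hq' ?_ ?_
  · rw [← map_mul, ← map_mul, key]
  · rw [← map_mul, ← map_mul, ← map_mul, ← map_mul, ← map_add, ← map_add, key']

theorem add_rule_aux {K : Type*} [Field K] {a b a' b' p q p' q' : K} (hb : b ≠ 0)
    (hq : q ≠ 0) :
    ((a' * q + a * q' + (b' * p + b * p')) * (b * q) - (a * q + b * p) * (b' * q + b * q'))
      / (b * q) ^ 2 = (a' * b - a * b') / b ^ 2 + (p' * q - p * q') / q ^ 2 := by
  field_simp
  ring

theorem mul_rule_aux {K : Type*} [Field K] {a b a' b' p q p' q' : K} (hb : b ≠ 0)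
    (hq : q ≠ 0) :
    ((a' * p + a * p') * (b * q) - (a * p) * (b' * q + b * q'))
      / (b * q) ^ 2 = a / b * ((p' * q - p * q') / q ^ 2) + p / q * ((a' * b - a * b') / b ^ 2) := by
  field_simp
  ring

/-- `d/dz` as a derivation of `ℂ(z)` over `ℂ`. -/
noncomputable def ratDeriv : Derivation ℂ (RatFunc ℂ) (RatFunc ℂ) :=
  Derivation.mk'
    { toFun := ratDerivFun
      map_add' := by
        intro f g
        have hf : algebraMap ℂ[X] (RatFunc ℂ) f.denom ≠ 0 :=
          RatFunc.algebraMap_ne_zero (RatFunc.denom_ne_zero f)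
        have hg : algebraMap ℂ[X] (RatFunc ℂ) g.denom ≠ 0 :=
          RatFunc.algebraMap_ne_zero (RatFunc.denom_ne_zero g)
        have h : f + g = algebraMap ℂ[X] (RatFunc ℂ) (f.num * g.denom + f.denom * g.num) /
            algebraMap ℂ[X] (RatFunc ℂ) (f.denom * g.denom) := by
          conv_lhs => rw [← RatFunc.num_div_denom f, ← RatFunc.num_div_denom g]
          rw [div_add_div _ _ hf hg]
          simp only [map_add, map_mul]
        rw [ratDerivFun_div _ _ (mul_ne_zero (RatFunc.denom_ne_zero f)
          (RatFunc.denom_ne_zero g)) _ h]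
        simp only [derivative_mul, map_add, map_mul]
        exact add_rule_aux hf hg
      map_smul' := by
        intro c f
        have hf : algebraMap ℂ[X] (RatFunc ℂ) f.denom ≠ 0 :=
          RatFunc.algebraMap_ne_zero (RatFunc.denom_ne_zero f)
        have h : c • f = algebraMap ℂ[X] (RatFunc ℂ) (C c * f.num) /
            algebraMap ℂ[X] (RatFunc ℂ) f.denom := by
          conv_lhs => rw [← RatFunc.num_div_denom f]
          rw [map_mul, RatFunc.algebraMap_C, RatFunc.smul_eq_C_mul, mul_div_assoc]
        rw [ratDerivFun_div _ _ (RatFunc.denom_ne_zero f) _ h]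
        unfold ratDerivFun
        simp only [derivative_mul, derivative_C, zero_mul, zero_add, map_mul,
          RatFunc.algebraMap_C, RingHom.id_apply, RatFunc.smul_eq_C_mul]
        ring }
    (by
      intro f g
      have hf : algebraMap ℂ[X] (RatFunc ℂ) f.denom ≠ 0 :=
        RatFunc.algebraMap_ne_zero (RatFunc.denom_ne_zero f)
      have hg : algebraMap ℂ[X] (RatFunc ℂ) g.denom ≠ 0 :=
        RatFunc.algebraMap_ne_zero (RatFunc.denom_ne_zero g)
      have h : f * g = algebraMap ℂ[X] (RatFunc ℂ) (f.num * g.num) /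
          algebraMap ℂ[X] (RatFunc ℂ) (f.denom * g.denom) := by
        conv_lhs => rw [← RatFunc.num_div_denom f, ← RatFunc.num_div_denom g]
        rw [div_mul_div_comm]
        simp only [map_mul]
      change ratDerivFun (f * g) = f • ratDerivFun g + g • ratDerivFun f
      rw [ratDerivFun_div _ _ (mul_ne_zero (RatFunc.denom_ne_zero f)
          (RatFunc.denom_ne_zero g)) _ h]
      simp only [derivative_mul, map_add, map_mul, smul_eq_mul]
      refine (mul_rule_aux hf hg).trans ?_
      rw [RatFunc.num_div_denom, RatFunc.num_div_denom]
      rfl)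

theorem ratDeriv_algebraMap (p : ℂ[X]) :
    ratDeriv (algebraMap ℂ[X] (RatFunc ℂ) p) = algebraMap ℂ[X] (RatFunc ℂ) (derivative p) := by
  have h := ratDerivFun_div p 1 one_ne_zero (algebraMap ℂ[X] (RatFunc ℂ) p) (by simp)
  simp only [map_one, div_one, derivative_one, map_zero, mul_zero, sub_zero, mul_one,
    one_pow] at h
  exact h

section Lenard

variable {R : Type*} [CommRing R] [Algebra ℂ R] (d : Derivation ℂ R R)

/-- The Lenard differential polynomials `L_k[u]`, evaluated at an element `u` of a commutative
`ℂ`-algebra with a derivation `d`: `L_0 = 1/2`, `L_1 = u`, `L_2 = u'' + 3u²`, ...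
The recursion below needs no integration; `lenard_recursion` proves the Lenard relation
`(L_{k+1})' = L_k''' + 4 u L_k' + 2 u' L_k`, and `lenard_succ_zero` that the constants of
integration are the usual ones (`L_k` has no constant term for `k ≥ 1`). -/
noncomputable def lenard (u : R) : ℕ → R
  | 0 => algebraMap ℂ R (1 / 2)
  | k + 1 =>
      (∑ i : Fin (k + 1),
        (2 * lenard u i * d (d (lenard u (k - i))) - d (lenard u i) * d (lenard u (k - i))
          + 4 * u * lenard u i * lenard u (k - i)))
      - ∑ i : Fin k, lenard u (i + 1) * lenard u (k - i)
  termination_by k => k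
  decreasing_by all_goals omega

theorem lenard_zero (u : R) : lenard d u 0 = algebraMap ℂ R (1 / 2) := by
  rw [lenard]

/-- The quadratic relation behind the recursion. -/
theorem lenard_quadratic (u : R) (k : ℕ) :
    ∑ p ∈ Finset.HasAntidiagonal.antidiagonal (k + 1), lenard d u p.1 * lenard d u p.2 =
      ∑ p ∈ Finset.HasAntidiagonal.antidiagonal k, (2 * lenard d u p.1 * d (d (lenard d u p.2))
        - d (lenard d u p.1) * d (lenard d u p.2) + 4 * u * lenard d u p.1 * lenard d u p.2) := by
  have h2 : (2 : R) * algebraMap ℂ R (1 / 2) = 1 := by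
    rw [← map_ofNat (algebraMap ℂ R) 2, ← map_mul]; norm_num
  have e := lenard.eq_2 d u k
  rw [Fin.sum_univ_eq_sum_range (fun i => 2 * lenard d u i * d (d (lenard d u (k - i)))
        - d (lenard d u i) * d (lenard d u (k - i))
          + 4 * u * lenard d u i * lenard d u (k - i)),
    Fin.sum_univ_eq_sum_range (fun i => lenard d u (i + 1) * lenard d u (k - i))] at e
  rw [Finset.Nat.sum_antidiagonal_eq_sum_range_succ_mk,
    Finset.Nat.sum_antidiagonal_eq_sum_range_succ_mk, Finset.sum_range_succ,
    Finset.sum_range_succ']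
  simp only [Nat.sub_self, Nat.sub_zero, lenard_zero, Nat.add_sub_add_right]
  linear_combination e + lenard d u (k + 1) * h2

/-- The Lenard recursion relation. -/
theorem lenard_recursion (u : R) (k : ℕ) :
    d (lenard d u (k + 1)) =
      d (d (d (lenard d u k))) + 4 * u * d (lenard d u k) + 2 * d u * lenard d u k := by
  have h2 : (2 : R) * algebraMap ℂ R (1 / 2) = 1 := by
    rw [← map_ofNat (algebraMap ℂ R) 2, ← map_mul]; norm_num
  have d2 : d (2 : R) = 0 := by exact_mod_cast d.map_natCast 2
  have d4 : d (4 : R) = 0 := by exact_mod_cast d.map_natCast 4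
  have d0 : d (lenard d u 0) = 0 := by rw [lenard_zero]; exact d.map_algebraMap _
  set a := lenard d u with ha
  set D : ℕ → R := fun j => d (a (j + 1)) -
    (d (d (d (a j))) + 4 * u * d (a j) + 2 * d u * a j) with hD
  have hsum : ∀ k, ∑ p ∈ Finset.HasAntidiagonal.antidiagonal k, a p.1 * D p.2 = 0 := by
    intro k
    have q := congrArg d (lenard_quadratic d u k)
    rw [map_sum, map_sum, ← ha] at q
    simp only [Derivation.map_add, Derivation.map_sub, Derivation.leibniz, smul_eq_mul,
      d2, d4] at q
    have s1 : ∑ p ∈ Finset.HasAntidiagonal.antidiagonal (k + 1), (a p.1 * d (a p.2) + a p.2 * d (a p.1)) =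
        2 * ∑ p ∈ Finset.HasAntidiagonal.antidiagonal k, a p.1 * d (a (p.2 + 1)) := by
      rw [Finset.sum_add_distrib,
        ← Finset.Nat.sum_antidiagonal_swap (f := fun p : ℕ × ℕ => a p.2 * d (a p.1))]
      simp only [Prod.fst_swap, Prod.snd_swap]
      rw [Finset.Nat.sum_antidiagonal_succ' (f := fun p : ℕ × ℕ => a p.1 * d (a p.2)), d0]
      ring
    have sw : ∀ f : ℕ × ℕ → R, ∑ p ∈ Finset.HasAntidiagonal.antidiagonal k, f p.swap =
        ∑ p ∈ Finset.HasAntidiagonal.antidiagonal k, f p := fun f => Finset.Nat.sum_antidiagonal_swap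
    have t1 := sw (fun p => d (a p.1) * d (d (a p.2)))
    have t2 := sw (fun p => u * a p.1 * d (a p.2))
    simp only [Prod.fst_swap, Prod.snd_swap] at t1 t2
    rw [s1] at q
    have q2 : 2 * ∑ p ∈ Finset.HasAntidiagonal.antidiagonal k, a p.1 * D p.2 = 0 := by
      have e : ∀ p : ℕ × ℕ, a p.1 * D p.2 = a p.1 * d (a (p.2 + 1)) -
        (a p.1 * d (d (d (a p.2))) + 4 * (u * a p.1 * d (a p.2)) + 2 * (d u * a p.1 * a p.2)) := by
        intro p; simp only [hD]; ring
      simp only [e]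
      rw [Finset.sum_sub_distrib, mul_sub, q, sub_eq_zero]
      rw [← sub_eq_zero] at t1 t2 ⊢
      rw [← Finset.sum_sub_distrib] at t1 t2
      rw [Finset.mul_sum, ← Finset.sum_sub_distrib]
      refine Eq.trans ?_ (congrArg₂ (fun x y => (-1) * x + 4 * y) t1 t2 |>.trans (by simp))
      rw [Finset.mul_sum, Finset.mul_sum, ← Finset.sum_add_distrib]
      exact Finset.sum_congr rfl fun p _ => by ring
    calc _ = algebraMap ℂ R (1 / 2) * (2 * ∑ p ∈ Finset.HasAntidiagonal.antidiagonal k, a p.1 * D p.2) := by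
          rw [← mul_assoc, mul_comm _ (2 : R), h2, one_mul]
      _ = 0 := by rw [q2, mul_zero]
  have hD0 : ∀ k, D k = 0 := by
    intro k
    induction k using Nat.strong_induction_on with
    | _ k ih =>
      have h := hsum k
      rw [Finset.Nat.sum_antidiagonal_eq_sum_range_succ_mk, Finset.sum_range_succ'] at h
      rw [Finset.sum_eq_zero (fun i hi => by
        rw [Finset.mem_range] at hi
        simp only [ih (k - (i + 1)) (by omega), mul_zero])] at h
      simp only [Nat.sub_zero, zero_add] at h
      have h0 : a 0 = algebraMap ℂ R (1 / 2) := lenard_zero d u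
      rw [h0] at h
      linear_combination 2 * h - D k * h2
  exact sub_eq_zero.mp (hD0 k)

/-- The normalization of the constants of integration. -/
theorem lenard_succ_zero (k : ℕ) : lenard d (0 : R) (k + 1) = 0 := by
  induction k using Nat.strong_induction_on with
  | _ k ih =>
    have hd : ∀ j, j ≤ k → d (lenard d (0 : R) j) = 0 := by
      intro j hj
      cases j with
      | zero => rw [lenard_zero]; exact d.map_algebraMap _
      | succ j => rw [ih j (by omega), map_zero]
    rw [lenard]
    rw [Finset.sum_eq_zero, Finset.sum_eq_zero, sub_zero]
    · intro i _
      rw [ih i i.2, zero_mul]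
    · intro i _
      rw [hd (k - i) (by omega), map_zero]
      simp

theorem lenard_one (u : R) : lenard d u 1 = u := by
  have h2 : (2 : R) * algebraMap ℂ R (1 / 2) = 1 := by
    rw [← map_ofNat (algebraMap ℂ R) 2, ← map_mul]; norm_num
  rw [lenard, Fin.sum_univ_one, Fin.sum_univ_zero]
  simp only [Fin.val_zero, Nat.sub_zero, lenard_zero, Derivation.map_algebraMap, map_zero]
  linear_combination (2 * u * algebraMap ℂ R (1 / 2) + u) * h2

end Lenard

/-- The left-hand side of the `N`-th equation of the second Painlevé hierarchy,
`(d/dz + 2w) L_N[w' - w²] - z w - α`, for a rational function `w` of `z`. -/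
noncomputable def painleveII (N : ℕ) (w : RatFunc ℂ) (α : ℂ) : RatFunc ℂ :=
  ratDeriv (lenard ratDeriv (ratDeriv w - w ^ 2) N)
    + 2 * w * lenard ratDeriv (ratDeriv w - w ^ 2) N
    - RatFunc.X * w - RatFunc.C α

/-- The logarithmic derivative `d/dz ln (P / Q)` of a quotient of two polynomials. -/
noncomputable def logDerivQuot (P Q : ℂ[X]) : RatFunc ℂ :=
  ratDeriv (algebraMap ℂ[X] (RatFunc ℂ) P / algebraMap ℂ[X] (RatFunc ℂ) Q)
    / (algebraMap ℂ[X] (RatFunc ℂ) P / algebraMap ℂ[X] (RatFunc ℂ) Q)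

/-- `Q 0, Q 1, Q 2, ...` are the (generalized) Yablonskii–Vorob'ev polynomials of the `N`-th
equation: monic polynomials with `Q 0 = 1`, `Q 1 = z`, such that for every `n ≥ 1` the function
`w(z; n) = d/dz ln (Q_{n-1} / Q_n)` solves the `N`-th equation with parameter `α = n`. -/
structure IsYablonskiiVorobev (N : ℕ) (Q : ℕ → ℂ[X]) : Prop where
  monic : ∀ n, (Q n).Monic
  zero : Q 0 = 1
  one : Q 1 = X
  solution : ∀ n, 1 ≤ n → painleveII N (logDerivQuot (Q (n - 1)) (Q n)) (n : ℂ) = 0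

/-- The coefficient `A_{k}` of `Q = ∑_{k=0}^{p} A_k z^{p-k}`, `p = deg Q`, where `0 ≤ k ≤ p`. -/
noncomputable def coeffA (Q : ℂ[X]) (k : ℕ) : ℂ := Q.coeff (Q.natDegree - k)

/-- `n_0 = ⌈√(1/4 + 2(2N+1)l) - 1/2⌉`, a nonnegative integer. -/
noncomputable def nZero (N l : ℕ) : ℕ :=
  ⌈Real.sqrt (1 / 4 + 2 * (2 * N + 1) * l) - 1 / 2⌉₊

/-- `T(n) = n (n - 1) ⋯ (n - (m - 1))`, as a polynomial in `n`. -/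
noncomputable def polyT (m : ℕ) : ℂ[X] := ∏ i ∈ Finset.range m, (X - C (i : ℂ))

end PainleveII

/-! Existence. Put `ψ = Q_{n-1}/Q_n`, so that `w = ψ'/ψ`, and let `F(w) = (d + 2w) L_N[w' - w²]` be
the mKdV polynomial. As `F` is odd in `w` (`mkdv_odd`), the equation can be rewritten through the
potential `u = -w' - w² = -ψ''/ψ`: it says that `M = 2 L_N[u] - z` satisfies `M' - 2wM = -(2n+1)`.
Hence `φ = -M/ψ` has constant Wronskian `2n+1` with `ψ` and is a second solution of `y'' + uy = 0`;
writing `φ = Q_{n+1}/Q_n` gives the next member (`exists_next`). The Hirota equation for neighbours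
says `u = 2 (ln Q_n)''`, so it passes from `(Q_{n-1}, Q_n)` to `(Q_n, Q_{n+1})`. It also restricts
the multiplicities of roots enough to exclude poles of `Q_{n+1}`
(`exists_polynomial_of_ratDeriv_div`).

Uniqueness and polynomiality. The equation reads `w = (F(w) - n)/z`, and each iteration of the right
side gains one order in `1/z`. This gives uniqueness, and it shows that the expansion of `w` at
infinity has coefficients polynomial in `n`. Since `z Q_n'/Q_n` is minus the sum of `zw` over the
parameters `1, ..., n`, its coefficients `s_i(n)` are polynomials in `n` as well. Comparing
coefficients in `z Q_n' = Q_n · (z Q_n'/Q_n)` yields `k A_k = -∑_{i<k} A_i s_{k-i}`, a recursion for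
`A_k` as a polynomial in `n` (`coeffPoly`).

Degree and roots. Weights give `s_i = 0` for `0 < i < 2N+1` and `(2N+1) deg s_i ≤ 2(2N+1) + 2Ni`,
while `s_{2N+1}` has degree exactly `2N+2`. So the top term of `A_{(2N+1)l}` comes only from
`A_{(2N+1)(l-1)} s_{2N+1}`. The recursion computes the coefficients of the reversed polynomial for
every `n`, and these vanish beyond the degree `n(n+1)/2`; this gives the roots `0, ..., n_0 - 1`. -/

namespace PainleveII

/-! ### Differential polynomials: weight, congruences, change of ring -/

section DifferentialRing

variable {R : Type*} [CommRing R] [Algebra ℂ R] (d : Derivation ℂ R R)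

/-- The Lenard polynomial `L_k` has weight `2k`. -/
theorem lenard_mem (Φ : ℕ → AddSubgroup R) (h0 : ∀ c : ℂ, algebraMap ℂ R c ∈ Φ 0)
    (hmul : ∀ i j a b, a ∈ Φ i → b ∈ Φ j → a * b ∈ Φ (i + j))
    (hd : ∀ i a, a ∈ Φ i → d a ∈ Φ (i + 1)) {u : R} (hu : u ∈ Φ 2) (k : ℕ) :
    lenard d u k ∈ Φ (2 * k) := by
  induction k using Nat.strong_induction_on with
  | _ k ih =>
    cases k with
    | zero => rw [lenard_zero]; exact h0 _
    | succ k =>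
      have h2 : (2 : R) ∈ Φ 0 := map_ofNat (algebraMap ℂ R) 2 ▸ h0 2
      have h4 : (4 : R) ∈ Φ 0 := map_ofNat (algebraMap ℂ R) 4 ▸ h0 4
      rw [lenard]
      refine sub_mem (sum_mem fun i _ => ?_) (sum_mem fun i _ => ?_)
      · have hi := i.2
        have a := ih i (by omega)
        have b := ih (k - i) (by omega)
        have e1 : 0 + 2 * (i : ℕ) + (2 * (k - i) + 1 + 1) = 2 * (k + 1) := by omega
        have e2 : 2 * (i : ℕ) + 1 + (2 * (k - i) + 1) = 2 * (k + 1) := by omega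
        have e3 : 0 + 2 + 2 * (i : ℕ) + 2 * (k - i) = 2 * (k + 1) := by omega
        refine add_mem (sub_mem ?_ ?_) ?_
        · exact e1 ▸ hmul _ _ _ _ (hmul _ _ _ _ h2 a) (hd _ _ (hd _ _ b))
        · exact e2 ▸ hmul _ _ _ _ (hd _ _ a) (hd _ _ b)
        · exact e3 ▸ hmul _ _ _ _ (hmul _ _ _ _ (hmul _ _ _ _ h4 hu) a) b
      · have hi := i.2
        have e : 2 * ((i : ℕ) + 1) + 2 * (k - i) = 2 * (k + 1) := by omega
        exact e ▸ hmul _ _ _ _ (ih (i + 1) (by omega)) (ih (k - i) (by omega))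

/-- `L_k` respects congruences modulo a differential ideal `I` of a differential subring `S`. -/
theorem lenard_sub_mem (S : Subring R) (I : AddSubgroup R) (h0 : ∀ c : ℂ, algebraMap ℂ R c ∈ S)
    (hS : ∀ a ∈ S, d a ∈ S) (hI : ∀ a ∈ I, d a ∈ I) (hSI : ∀ a ∈ S, ∀ b ∈ I, a * b ∈ I)
    {u v : R} (hu : u ∈ S) (hv : v ∈ S) (huv : u - v ∈ I) (k : ℕ) :
    lenard d u k - lenard d v k ∈ I := by
  have mS : ∀ x ∈ S, ∀ k, lenard d x k ∈ S := fun x hx k =>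
    lenard_mem d (fun _ => S.toAddSubgroup) h0 (fun _ _ _ _ => S.mul_mem) (fun _ => hS) hx k
  have hmul : ∀ a ∈ S, ∀ b' ∈ S, ∀ a' b, a - a' ∈ I → b - b' ∈ I → a * b - a' * b' ∈ I := by
    intro a ha b' hb' a' b h1 h2
    have := add_mem (hSI _ ha _ h2) (hSI _ hb' _ h1)
    convert this using 1
    ring
  induction k using Nat.strong_induction_on with
  | _ k ih =>
    cases k with
    | zero => rw [lenard_zero, lenard_zero, sub_self]; exact I.zero_mem
    | succ k =>
      have h2 : (2 : R) ∈ S := ofNat_mem S 2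
      have h4 : (4 : R) ∈ S := ofNat_mem S 4
      have hdI : ∀ a b, a - b ∈ I → d a - d b ∈ I := fun a b h => by
        rw [← map_sub]; exact hI _ h
      rw [lenard, lenard, sub_sub_sub_comm, ← Finset.sum_sub_distrib, ← Finset.sum_sub_distrib]
      refine sub_mem (sum_mem fun i _ => ?_) (sum_mem fun i _ => ?_)
      · have hi := i.2
        have a := ih i (by omega)
        have b := ih (k - i) (by omega)
        have z : ∀ c : R, c - c ∈ I := fun c => by rw [sub_self]; exact I.zero_mem
        have au := mS u hu i
        have bv := mS v hv (k - i)
        rw [add_sub_add_comm, sub_sub_sub_comm]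
        refine add_mem (sub_mem ?_ ?_) ?_
        · exact hmul _ (mul_mem h2 au) _ (hS _ (hS _ bv)) _ _
            (hmul _ h2 _ (mS v hv i) _ _ (z _) a) (hdI _ _ (hdI _ _ b))
        · exact hmul _ (hS _ au) _ (hS _ bv) _ _ (hdI _ _ a) (hdI _ _ b)
        · exact hmul _ (mul_mem (mul_mem h4 hu) au) _ bv _ _ (hmul _ (mul_mem h4 hu) _ (mS v hv i)
            _ _ (hmul _ h4 _ hv _ _ (z _) huv) a) b
      · have hi := i.2
        exact hmul _ (mS u hu _) _ (mS v hv _) _ _ (ih (i + 1) (by omega)) (ih (k - i) (by omega))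

theorem map_lenard {R' : Type*} [CommRing R'] [Algebra ℂ R'] (d' : Derivation ℂ R' R')
    (f : R →ₐ[ℂ] R') (hf : ∀ a, f (d a) = d' (f a)) (u : R) (k : ℕ) :
    f (lenard d u k) = lenard d' (f u) k := by
  induction k using Nat.strong_induction_on with
  | _ k ih =>
    cases k with
    | zero => rw [lenard_zero, lenard_zero, AlgHom.commutes]
    | succ k =>
      rw [lenard, lenard, map_sub, map_sum, map_sum]
      congr 1
      · refine Finset.sum_congr rfl fun i _ => ?_
        have hi := i.2
        simp only [map_add, map_sub, map_mul, hf, ih i (by omega), ih (k - i) (by omega), map_ofNat]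
      · refine Finset.sum_congr rfl fun i _ => ?_
        have hi := i.2
        rw [map_mul, ih (i + 1) (by omega), ih (k - i) (by omega)]

/-- The differential polynomial `(d + 2w) L_N[w' - w²]`. -/
noncomputable def mkdv (N : ℕ) (w : R) : R :=
  d (lenard d (d w - w ^ 2) N) + 2 * w * lenard d (d w - w ^ 2) N

theorem map_mkdv {R' : Type*} [CommRing R'] [Algebra ℂ R'] (d' : Derivation ℂ R' R')
    (f : R →ₐ[ℂ] R') (hf : ∀ a, f (d a) = d' (f a)) (N : ℕ) (w : R) :
    f (mkdv d N w) = mkdv d' N (f w) := by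
  simp only [mkdv, map_add, map_mul, map_ofNat, hf, map_lenard d d' f hf, map_sub, map_pow]

/-- `Φ` stands for any multiplicative filtration in which `d` raises the index by one. Divisibility
by powers of `1/z` and the degree bound in `n` are both instances. -/
theorem mkdv_mem (Φ : ℕ → AddSubgroup R) (h0 : ∀ c : ℂ, algebraMap ℂ R c ∈ Φ 0)
    (hmul : ∀ i j a b, a ∈ Φ i → b ∈ Φ j → a * b ∈ Φ (i + j))
    (hd : ∀ i a, a ∈ Φ i → d a ∈ Φ (i + 1)) {w : R} (hw : w ∈ Φ 1) (N : ℕ) :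
    mkdv d N w ∈ Φ (2 * N + 1) := by
  have h2 : (2 : R) ∈ Φ 0 := map_ofNat (algebraMap ℂ R) 2 ▸ h0 2
  have hu : d w - w ^ 2 ∈ Φ 2 := sub_mem (hd _ _ hw) (sq w ▸ hmul _ _ _ _ hw hw)
  have hL := lenard_mem d Φ h0 hmul hd hu N
  have e : 0 + 1 + 2 * N = 2 * N + 1 := by omega
  exact add_mem (hd _ _ hL) (e ▸ hmul _ _ _ _ (hmul _ _ _ _ h2 hw) hL)

theorem mkdv_sub_mem (S : Subring R) (I : AddSubgroup R) (h0 : ∀ c : ℂ, algebraMap ℂ R c ∈ S)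
    (hS : ∀ a ∈ S, d a ∈ S) (hI : ∀ a ∈ I, d a ∈ I) (hSI : ∀ a ∈ S, ∀ b ∈ I, a * b ∈ I)
    {v w : R} (hv : v ∈ S) (hw : w ∈ S) (hvw : v - w ∈ I) (N : ℕ) :
    mkdv d N v - mkdv d N w ∈ I := by
  have h2 : (2 : R) ∈ S := ofNat_mem S 2
  have mS : ∀ x ∈ S, d x - x ^ 2 ∈ S := fun x hx => sub_mem (hS _ hx) (pow_mem hx 2)
  have hu : d v - v ^ 2 - (d w - w ^ 2) ∈ I := by
    have := sub_mem (hI _ hvw) (hSI _ (add_mem hv hw) _ hvw)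
    rw [map_sub] at this
    convert this using 1
    ring
  have hL := lenard_sub_mem d S I h0 hS hI hSI (mS v hv) (mS w hw) hu N
  have hLw := lenard_mem d (fun _ => S.toAddSubgroup) h0 (fun _ _ _ _ => S.mul_mem) (fun _ => hS)
    (mS w hw) N
  have := add_mem (hI _ hL) (add_mem (hSI _ (mul_mem h2 hv) _ hL)
    (hSI _ (mul_mem h2 hLw) _ hvw))
  rw [map_sub] at this
  unfold mkdv
  convert this using 1
  ring

end DifferentialRing

/-! ### Rational functions and their order at infinity -/

theorem painleveII_eq (N : ℕ) (w : RatFunc ℂ) (α : ℂ) :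
    painleveII N w α = mkdv ratDeriv N w - RatFunc.X * w - RatFunc.C α := rfl

/-- The rational functions that are `O(z^{-k})` at infinity. -/
noncomputable def vanishAtInfty (k : ℤ) : AddSubgroup (RatFunc ℂ) where
  carrier := {f | f = 0 ∨ f.intDegree ≤ -k}
  zero_mem' := Or.inl rfl
  neg_mem' := by
    rintro f (rfl | h)
    · exact Or.inl neg_zero
    · exact Or.inr (by rwa [RatFunc.intDegree_neg])
  add_mem' := by
    rintro f g hf hg
    by_cases hg0 : g = 0
    · rwa [hg0, add_zero]
    by_cases hf0 : f = 0
    · rwa [hf0, zero_add]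
    by_cases hs : f + g = 0
    · exact Or.inl hs
    · exact Or.inr ((RatFunc.intDegree_add_le hg0 hs).trans
        (max_le (hf.resolve_left hf0) (hg.resolve_left hg0)))

theorem mem_vanishAtInfty {k : ℤ} {f : RatFunc ℂ} :
    f ∈ vanishAtInfty k ↔ f = 0 ∨ f.intDegree ≤ -k := Iff.rfl

theorem vanishAtInfty_anti {k l : ℤ} (h : k ≤ l) {f : RatFunc ℂ} (hf : f ∈ vanishAtInfty l) :
    f ∈ vanishAtInfty k := hf.imp id (fun h' => h'.trans (neg_le_neg h))

theorem mul_mem_vanishAtInfty {k l : ℤ} {f g : RatFunc ℂ} (hf : f ∈ vanishAtInfty k)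
    (hg : g ∈ vanishAtInfty l) : f * g ∈ vanishAtInfty (k + l) := by
  by_cases hf0 : f = 0
  · exact Or.inl (by rw [hf0, zero_mul])
  by_cases hg0 : g = 0
  · exact Or.inl (by rw [hg0, mul_zero])
  refine Or.inr ?_
  rw [RatFunc.intDegree_mul hf0 hg0]
  have := hf.resolve_left hf0
  have := hg.resolve_left hg0
  omega

theorem C_mem_vanishAtInfty (c : ℂ) : RatFunc.C c ∈ vanishAtInfty 0 :=
  Or.inr (by rw [RatFunc.intDegree_C]; rfl)

theorem X_mem_vanishAtInfty : (RatFunc.X : RatFunc ℂ) ∈ vanishAtInfty (-1) :=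
  Or.inr (by rw [RatFunc.intDegree_X]; rfl)

theorem inv_X_mem_vanishAtInfty : (RatFunc.X : RatFunc ℂ)⁻¹ ∈ vanishAtInfty 1 :=
  Or.inr (by rw [RatFunc.intDegree_inv, RatFunc.intDegree_X])

theorem algebraMap_mem_vanishAtInfty {p : ℂ[X]} {k : ℤ} (hp : p ≠ 0) :
    algebraMap ℂ[X] (RatFunc ℂ) p ∈ vanishAtInfty k ↔ (p.natDegree : ℤ) ≤ -k := by
  rw [mem_vanishAtInfty, RatFunc.intDegree_polynomial, or_iff_right]
  exact RatFunc.algebraMap_ne_zero hp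

theorem div_mem_vanishAtInfty {p q : ℂ[X]} (hq : q ≠ 0) {k : ℤ} (hp : p ≠ 0 →
    (p.natDegree : ℤ) - q.natDegree ≤ -k) :
    algebraMap ℂ[X] (RatFunc ℂ) p / algebraMap ℂ[X] (RatFunc ℂ) q ∈ vanishAtInfty k := by
  by_cases hp0 : p = 0
  · exact Or.inl (by rw [hp0, map_zero, zero_div])
  · refine Or.inr ?_
    rw [RatFunc.intDegree_div (RatFunc.algebraMap_ne_zero hp0) (RatFunc.algebraMap_ne_zero hq),
      RatFunc.intDegree_polynomial, RatFunc.intDegree_polynomial]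
    exact hp hp0

theorem ratDeriv_apply (f : RatFunc ℂ) : ratDeriv f =
    (algebraMap ℂ[X] (RatFunc ℂ) (derivative f.num) * algebraMap ℂ[X] (RatFunc ℂ) f.denom
    - algebraMap ℂ[X] (RatFunc ℂ) f.num * algebraMap ℂ[X] (RatFunc ℂ) (derivative f.denom))
    / algebraMap ℂ[X] (RatFunc ℂ) f.denom ^ 2 := rfl

theorem natDegree_derivative_mul_le {p q : ℂ[X]} (h : derivative p * q ≠ 0) :
    (derivative p * q).natDegree + 1 ≤ p.natDegree + q.natDegree := by
  have hp : p.natDegree ≠ 0 := fun h0 => h (by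
    rw [derivative_of_natDegree_zero h0, zero_mul])
  have h1 := natDegree_mul_le (p := derivative p) (q := q)
  have h2 := natDegree_derivative_lt hp
  omega

theorem ratDeriv_mem_vanishAtInfty {k : ℤ} {f : RatFunc ℂ} (hf : f ∈ vanishAtInfty k) :
    ratDeriv f ∈ vanishAtInfty (k + 1) := by
  by_cases hf0 : f = 0
  · exact Or.inl (by rw [hf0, map_zero])
  have h := hf.resolve_left hf0
  have hq := RatFunc.denom_ne_zero f
  rw [RatFunc.intDegree] at h
  rw [ratDeriv_apply, sub_div, ← map_mul, ← map_mul, ← map_pow]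
  refine sub_mem (div_mem_vanishAtInfty (pow_ne_zero 2 hq) fun h0 => ?_)
    (div_mem_vanishAtInfty (pow_ne_zero 2 hq) fun h0 => ?_)
  · have := natDegree_derivative_mul_le h0
    rw [natDegree_pow]
    push_cast
    omega
  · rw [mul_comm] at h0 ⊢
    have := natDegree_derivative_mul_le h0
    rw [natDegree_pow]
    push_cast
    omega

theorem eq_C_of_ratDeriv_eq_zero {f : RatFunc ℂ} (hf : ratDeriv f = 0) :
    ∃ c : ℂ, f = RatFunc.C c := by
  have hq := RatFunc.denom_ne_zero f
  rw [ratDeriv_apply, div_eq_zero_iff, or_iff_left (pow_ne_zero 2 (RatFunc.algebraMap_ne_zero hq)),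
    ← map_mul, ← map_mul, sub_eq_zero] at hf
  have h := RatFunc.algebraMap_injective ℂ hf
  have hdvd : f.denom ∣ derivative f.denom :=
    (RatFunc.isCoprime_num_denom f).symm.dvd_of_dvd_mul_left (h ▸ Dvd.intro_left _ rfl)
  have hq' := dvd_derivative_iff.mp hdvd
  have hp' : derivative f.num = 0 := by
    rw [hq', mul_zero] at h
    exact (mul_eq_zero.mp h).resolve_right hq
  obtain ⟨a, ha⟩ := natDegree_eq_zero.mp (derivative_eq_zero.mp hp')
  obtain ⟨b, hb⟩ := natDegree_eq_zero.mp (derivative_eq_zero.mp hq')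
  refine ⟨a / b, ?_⟩
  rw [← RatFunc.num_div_denom f, ← ha, ← hb, RatFunc.algebraMap_C, RatFunc.algebraMap_C, map_div₀]

theorem eq_zero_of_ratDeriv_eq_zero {f : RatFunc ℂ} (hf : ratDeriv f = 0)
    (h1 : f ∈ vanishAtInfty 1) : f = 0 := by
  obtain ⟨c, rfl⟩ := eq_C_of_ratDeriv_eq_zero hf
  refine h1.resolve_right fun h => ?_
  rw [RatFunc.intDegree_C] at h
  omega

theorem eq_zero_of_forall_mem_vanishAtInfty {f : RatFunc ℂ} (h : ∀ k : ℕ, f ∈ vanishAtInfty k) :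
    f = 0 := by
  by_contra h0
  have := (h ((-f.intDegree).toNat + 1)).resolve_left h0
  omega

theorem lenard_mem_vanishAtInfty {u : RatFunc ℂ} (hu : u ∈ vanishAtInfty 2) (k : ℕ) :
    lenard ratDeriv u k ∈ vanishAtInfty ((2 * k : ℕ) : ℤ) :=
  lenard_mem ratDeriv (fun k => vanishAtInfty k) C_mem_vanishAtInfty
    (fun i j a b ha hb => by push_cast; exact mul_mem_vanishAtInfty ha hb)
    (fun i a ha => by push_cast; exact ratDeriv_mem_vanishAtInfty ha) hu k

/-- The subring of rational functions that are regular at infinity. -/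
noncomputable def regularAtInfty : Subring (RatFunc ℂ) :=
  { vanishAtInfty 0 with
    one_mem' := by simpa using C_mem_vanishAtInfty 1
    mul_mem' := fun ha hb => by simpa using mul_mem_vanishAtInfty ha hb }

/-- The functions `O(z^{-k})` are stable under `d` and under multiplication by functions regular at
infinity, so the mKdV polynomial loses no order. The factor `1/z` in the equation then makes it a
contraction. -/
theorem mkdv_sub_mem_vanishAtInfty {v w : RatFunc ℂ} (hv : v ∈ vanishAtInfty 1)
    (hw : w ∈ vanishAtInfty 1) {k : ℤ} (h : v - w ∈ vanishAtInfty k) (N : ℕ) :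
    mkdv ratDeriv N v - mkdv ratDeriv N w ∈ vanishAtInfty k :=
  mkdv_sub_mem ratDeriv regularAtInfty (vanishAtInfty k) C_mem_vanishAtInfty
    (fun _ ha => vanishAtInfty_anti (by norm_num) (ratDeriv_mem_vanishAtInfty ha))
    (fun _ ha => vanishAtInfty_anti (by omega) (ratDeriv_mem_vanishAtInfty ha))
    (fun a ha b hb => by simpa using mul_mem_vanishAtInfty ha hb)
    (vanishAtInfty_anti (by norm_num) hv) (vanishAtInfty_anti (by norm_num) hw) h N

theorem ratDeriv_two : ratDeriv (2 : RatFunc ℂ) = 0 := by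
  exact_mod_cast ratDeriv.map_natCast 2

theorem ratDeriv_C (c : ℂ) : ratDeriv (RatFunc.C c) = 0 := ratDeriv.map_algebraMap c

theorem ratDeriv_X : ratDeriv RatFunc.X = 1 := by
  rw [← RatFunc.algebraMap_X, ratDeriv_algebraMap, derivative_X, map_one]

theorem ratDeriv_div (f : RatFunc ℂ) {g : RatFunc ℂ} (hg : g ≠ 0) :
    ratDeriv (f / g) = (ratDeriv f * g - f * ratDeriv g) / g ^ 2 := by
  have h := congrArg ratDeriv (div_mul_cancel₀ f hg)
  rw [Derivation.leibniz, smul_eq_mul, smul_eq_mul] at h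
  field_simp at h ⊢
  linear_combination h

/-! ### Oddness of the mKdV polynomial -/

theorem sub_sq_mem_vanishAtInfty {w : RatFunc ℂ} (hw : w ∈ vanishAtInfty 1) :
    ratDeriv w - w ^ 2 ∈ vanishAtInfty 2 :=
  sub_mem (ratDeriv_mem_vanishAtInfty hw) (sq w ▸ mul_mem_vanishAtInfty hw hw)

theorem neg_sub_sq_mem_vanishAtInfty {w : RatFunc ℂ} (hw : w ∈ vanishAtInfty 1) :
    -ratDeriv w - w ^ 2 ∈ vanishAtInfty 2 :=
  sub_mem (neg_mem (ratDeriv_mem_vanishAtInfty hw)) (sq w ▸ mul_mem_vanishAtInfty hw hw)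

/-- The modified KdV differential polynomial `(d + 2w) L_k[w' - w²]` is odd in `w`. -/
theorem mkdv_odd {w : RatFunc ℂ} (hw : w ∈ vanishAtInfty 1) (k : ℕ) :
    ratDeriv (lenard ratDeriv (-ratDeriv w - w ^ 2) k)
      - 2 * w * lenard ratDeriv (-ratDeriv w - w ^ 2) k = -mkdv ratDeriv k w := by
  unfold mkdv
  induction k with
  | zero =>
    simp only [lenard_zero, Derivation.map_algebraMap]
    ring
  | succ k ih =>
    have rA := lenard_recursion ratDeriv (ratDeriv w - w ^ 2) k
    have rB := lenard_recursion ratDeriv (-ratDeriv w - w ^ 2) k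
    have mA := lenard_mem_vanishAtInfty (sub_sq_mem_vanishAtInfty hw) (k + 1)
    have mB := lenard_mem_vanishAtInfty (neg_sub_sq_mem_vanishAtInfty hw) (k + 1)
    have mA' := lenard_mem_vanishAtInfty (sub_sq_mem_vanishAtInfty hw) k
    set A := lenard ratDeriv (ratDeriv w - w ^ 2) k
    set B := lenard ratDeriv (-ratDeriv w - w ^ 2) k
    set A' := lenard ratDeriv (ratDeriv w - w ^ 2) (k + 1)
    set B' := lenard ratDeriv (-ratDeriv w - w ^ 2) (k + 1)
    set Y := ratDeriv A + 2 * w * A with hY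
    -- Miura factorization: for `u = w' - w²` the Lenard operator `d³ + 4ud + 2u'` equals `(d - 2w)
    -- d (d + 2w)`. Replacing `w` by `-w` gives `hB`, with `Y = -(d - 2w)B` by induction.
    have hA : ratDeriv A' = ratDeriv (ratDeriv Y) - 2 * w * ratDeriv Y := by
      rw [rA, hY]
      simp only [map_add, map_sub, Derivation.leibniz, sq, smul_eq_mul, ratDeriv_two, map_zero]
      ring
    have hB : ratDeriv B' = -ratDeriv (ratDeriv Y) - 2 * w * ratDeriv Y := by
      have e : Y = -(ratDeriv B - 2 * w * B) := by rw [ih, neg_neg]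
      rw [rB, e]
      simp only [map_add, map_sub, map_neg, Derivation.leibniz, sq, smul_eq_mul, ratDeriv_two, map_zero]
      ring
    have mY : Y ∈ vanishAtInfty 0 := by
      have mA0 : A ∈ vanishAtInfty 0 := vanishAtInfty_anti (by positivity) mA'
      refine add_mem (vanishAtInfty_anti (by norm_num) (ratDeriv_mem_vanishAtInfty mA0)) ?_
      have := vanishAtInfty_anti (k := 0) (by norm_num) (mul_mem_vanishAtInfty hw mA0)
      rw [mul_assoc, two_mul]
      exact add_mem this this
    -- The derivative of the left side is zero by `hA` and `hB`; decay at infinity fixes the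
    -- constant of integration.
    have key : A' - B' - 2 * ratDeriv Y = 0 := by
      refine eq_zero_of_ratDeriv_eq_zero ?_ ?_
      · simp only [map_sub, hA, hB, Derivation.leibniz, smul_eq_mul, ratDeriv_two]
        ring
      · refine sub_mem (sub_mem (vanishAtInfty_anti (by push_cast; omega) mA)
          (vanishAtInfty_anti (by push_cast; omega) mB)) ?_
        have := ratDeriv_mem_vanishAtInfty mY
        rw [two_mul]
        exact add_mem this this
    rw [hA, hB]
    linear_combination (2 * w) * key

/-! ### Multiplicities of roots and absence of poles -/

section LocalAnalysis

variable {P Q : ℂ[X]} {x : ℂ}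

theorem X_sub_C_mul_derivative_pow_mul (a : ℕ) (p : ℂ[X]) (x : ℂ) :
    (X - C x) * derivative ((X - C x) ^ a * p) =
      (X - C x) ^ a * (C (a : ℂ) * p + (X - C x) * derivative p) := by
  rw [derivative_mul, derivative_X_sub_C_pow]
  cases a with
  | zero => simp
  | succ a =>
    simp only [map_natCast, Nat.add_sub_cancel, pow_succ]
    ring

theorem pow_X_sub_C_inj {i j : ℕ} {f g : ℂ[X]} (hf : f.eval x ≠ 0) (hg : g.eval x ≠ 0)
    (h : (X - C x) ^ i * f = (X - C x) ^ j * g) : i = j := by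
  wlog hij : i ≤ j generalizing i j f g
  · exact (this hg hf h.symm (le_of_not_ge hij)).symm
  obtain ⟨k, rfl⟩ := Nat.exists_eq_add_of_le hij
  rw [pow_add, mul_assoc] at h
  have h' := mul_left_cancel₀ (pow_ne_zero i (X_sub_C_ne_zero x)) h
  cases k with
  | zero => rfl
  | succ k =>
    exfalso
    apply hf
    rw [h']
    simp

/-- Solutions of the Hirota equation have triangular multiplicities. -/
theorem multiplicity_le_of_hirota {a b : ℕ} {P₁ Q₁ : ℂ[X]} (hP : P₁.eval x ≠ 0)
    (hQ : Q₁.eval x ≠ 0) (eP : P = (X - C x) ^ a * P₁) (eQ : Q = (X - C x) ^ b * Q₁)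
    (h : derivative (derivative P) * Q - 2 * derivative P * derivative Q
      + P * derivative (derivative Q) = 0) : a ≤ 2 * b + 1 := by
  have second : ∀ (a : ℕ) (p f : ℂ[X]), f = (X - C x) ^ a * p → ∃ q r : ℂ[X],
      (X - C x) * derivative f = (X - C x) ^ a * q ∧
      (X - C x) ^ 2 * derivative (derivative f) = (X - C x) ^ a * r ∧
      q.eval x = a * p.eval x ∧ r.eval x = a * (a - 1) * p.eval x := by
    intro a p f hf
    have h1 := X_sub_C_mul_derivative_pow_mul a p x
    rw [← hf] at h1
    set q := C (a : ℂ) * p + (X - C x) * derivative p with hq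
    have h2 := X_sub_C_mul_derivative_pow_mul a q x
    rw [← h1, derivative_mul, derivative_X_sub_C] at h2
    refine ⟨q, C (a : ℂ) * q + (X - C x) * derivative q - q, h1, ?_, ?_, ?_⟩
    · linear_combination h2 - h1
    · simp [hq]
    · simp [hq]
      ring
  obtain ⟨q1, r1, h1, h2, h3, h4⟩ := second a P₁ P eP
  obtain ⟨q2, r2, h5, h6, h7, h8⟩ := second b Q₁ Q eQ
  have e : (X - C x) ^ (a + b) * (r1 * Q₁ - 2 * q1 * q2 + P₁ * r2) = 0 := by
    rw [pow_add]
    linear_combination (X - C x) ^ 2 * h - (X - C x) ^ b * Q₁ * h2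
      + 2 * (X - C x) * derivative Q * h1 + 2 * (X - C x) ^ a * q1 * h5 - (X - C x) ^ a * P₁ * h6
      - (X - C x) ^ 2 * derivative (derivative P) * eQ
      - (X - C x) ^ 2 * derivative (derivative Q) * eP
  have e' := (mul_eq_zero.mp e).resolve_left (pow_ne_zero _ (X_sub_C_ne_zero x))
  have e2 := congrArg (eval x) e'
  simp only [eval_add, eval_sub, eval_mul, eval_ofNat, h3, h4, h7, h8, eval_zero] at e2
  -- The lowest coefficient at `x` is `a(a-1) - 2ab + b(b-1) = (a-b)² - (a+b)`, which is positive
  -- once `a ≥ 2b + 2`.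
  have e3 : (P₁.eval x * Q₁.eval x) * (((a : ℂ) - b) ^ 2 - (a + b)) = 0 := by
    linear_combination e2
  have e4 := (mul_eq_zero.mp e3).resolve_left (mul_ne_zero hP hQ)
  have e5 : ((a : ℤ) - b) ^ 2 - (a + b) = 0 := by exact_mod_cast e4
  by_contra hlt
  push Not at hlt
  have : (2 * b + 2 : ℤ) ≤ a := by exact_mod_cast hlt
  nlinarith

theorem exists_pow_mul (p : ℂ[X]) (hp : p ≠ 0) (x : ℂ) :
    ∃ (a : ℕ) (q : ℂ[X]), p = (X - C x) ^ a * q ∧ q.eval x ≠ 0 := by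
  obtain ⟨q, h1, h2⟩ := exists_eq_pow_rootMultiplicity_mul_and_not_dvd p hp x
  exact ⟨_, q, h1, fun h => h2 (dvd_iff_isRoot.mpr h)⟩

/-- A rational function `F` with `(F / P)' = c Q² / P²` is a polynomial if `P, Q` solve the
Hirota equation. -/
theorem exists_polynomial_of_ratDeriv_div (hP : P ≠ 0) (hQ : Q ≠ 0)
    (h : derivative (derivative P) * Q - 2 * derivative P * derivative Q
      + P * derivative (derivative Q) = 0) {c : ℂ} (hc : c ≠ 0) {F : RatFunc ℂ}
    (hF : ratDeriv (F / algebraMap ℂ[X] (RatFunc ℂ) P) =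
      RatFunc.C c * algebraMap ℂ[X] (RatFunc ℂ) Q ^ 2 / algebraMap ℂ[X] (RatFunc ℂ) P ^ 2) :
    ∃ R : ℂ[X], algebraMap ℂ[X] (RatFunc ℂ) R = F := by
  have hD := RatFunc.denom_ne_zero F
  have hP' := RatFunc.algebraMap_ne_zero hP
  have hD' := RatFunc.algebraMap_ne_zero hD
  have key : (derivative F.num * (F.denom * P) - F.num * derivative (F.denom * P)) * P ^ 2 =
      C c * Q ^ 2 * (F.denom * P) ^ 2 := by
    have e : F / algebraMap ℂ[X] (RatFunc ℂ) P = algebraMap ℂ[X] (RatFunc ℂ) F.num /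
        algebraMap ℂ[X] (RatFunc ℂ) (F.denom * P) := by
      conv_lhs => rw [← RatFunc.num_div_denom F]
      rw [map_mul, div_div]
    rw [e, ratDeriv_div _ (RatFunc.algebraMap_ne_zero (mul_ne_zero hD hP)), ratDeriv_algebraMap,
      ratDeriv_algebraMap, div_eq_div_iff (pow_ne_zero 2 (RatFunc.algebraMap_ne_zero
        (mul_ne_zero hD hP))) (pow_ne_zero 2 hP'), ← RatFunc.algebraMap_C] at hF
    apply RatFunc.algebraMap_injective ℂ
    simpa only [map_mul, map_sub, map_pow] using hF
  suffices hu : IsUnit F.denom by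
    have : F.denom = 1 := (RatFunc.monic_denom F).eq_one_of_isUnit hu
    refine ⟨F.num, ?_⟩
    conv_rhs => rw [← RatFunc.num_div_denom F, this, map_one, div_one]
  by_contra hu
  obtain ⟨x, hx⟩ := Complex.exists_root (degree_pos_of_ne_zero_of_nonunit hD hu)
  have hnum : F.num.eval x ≠ 0 := by
    intro h0
    obtain ⟨s, t, hst⟩ := RatFunc.isCoprime_num_denom F
    have := congrArg (eval x) hst
    rw [eval_add, eval_mul, eval_mul, h0, IsRoot.def.mp hx] at this
    simp at this
  obtain ⟨a, P₁, eP, hP₁⟩ := exists_pow_mul P hP x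
  obtain ⟨b, Q₁, eQ, hQ₁⟩ := exists_pow_mul Q hQ x
  obtain ⟨δ, D₁, eD, hD₁⟩ := exists_pow_mul F.denom hD x
  have hab := multiplicity_le_of_hirota hP₁ hQ₁ eP eQ h
  have hδ : δ ≠ 0 := by
    rintro rfl
    rw [pow_zero, one_mul] at eD
    exact hD₁ (eD ▸ hx)
  have eB : F.denom * P = (X - C x) ^ (δ + a) * (D₁ * P₁) := by
    rw [pow_add]
    nth_rw 1 [eD, eP]
    ring
  have h1 := X_sub_C_mul_derivative_pow_mul (δ + a) (D₁ * P₁) x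
  rw [← eB] at h1
  set E := C ((δ + a : ℕ) : ℂ) * (D₁ * P₁) + (X - C x) * derivative (D₁ * P₁) with hE
  have fin : (X - C x) ^ (δ + a + 2 * a) * (((X - C x) * derivative F.num * (D₁ * P₁)
      - F.num * E) * P₁ ^ 2) = (X - C x) ^ (1 + 2 * b + 2 * (δ + a)) *
      (C c * Q₁ ^ 2 * (D₁ * P₁) ^ 2) := by
    have h2 := congrArg ((X - C x) * ·) key
    have eP2 : P ^ 2 = (X - C x) ^ (2 * a) * P₁ ^ 2 := by rw [eP]; ring
    have eQ2 : Q ^ 2 = (X - C x) ^ (2 * b) * Q₁ ^ 2 := by rw [eQ]; ring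
    have eB2 : (F.denom * P) ^ 2 = (X - C x) ^ (2 * (δ + a)) * (D₁ * P₁) ^ 2 := by rw [eB]; ring
    rw [← mul_assoc, mul_sub, mul_left_comm _ F.num, h1, eP2, eQ2, eB2, eB] at h2
    rw [pow_add _ (δ + a), pow_add _ _ (2 * (δ + a)), pow_add _ 1]
    linear_combination h2
  -- A pole of order `δ ≥ 1` of `F` gives `(F/P)'` a pole of order `δ + a + 1`, which must be `2a -
  -- 2b`. So `a = 2b + 1 + δ`, against `hab`.
  have := pow_X_sub_C_inj (x := x) ?_ ?_ fin
  · omega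
  · have : ((δ : ℂ) + a) ≠ 0 := by exact_mod_cast (by omega : δ + a ≠ 0)
    simp [hE, hnum, hD₁, hP₁, this]
  · simp [hc, hD₁, hP₁, hQ₁]

end LocalAnalysis

/-! ### The Hirota equation and the Bäcklund step -/

theorem ratDeriv_div_self_mem (f : RatFunc ℂ) : ratDeriv f / f ∈ vanishAtInfty 1 := by
  have h1 : f ∈ vanishAtInfty (-f.intDegree) := Or.inr (by omega)
  have h2 : f⁻¹ ∈ vanishAtInfty f.intDegree := Or.inr (by rw [RatFunc.intDegree_inv])
  have := mul_mem_vanishAtInfty (ratDeriv_mem_vanishAtInfty h1) h2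
  rw [div_eq_mul_inv]
  convert this using 1
  ring_nf

theorem logDerivQuot_mem (P Q : ℂ[X]) : logDerivQuot P Q ∈ vanishAtInfty 1 :=
  ratDeriv_div_self_mem _

/-- The Hirota bilinear equation `P'' Q - 2 P' Q' + P Q'' = 0`. -/
def Hirota (P Q : ℂ[X]) : Prop :=
  derivative (derivative P) * Q - 2 * derivative P * derivative Q
    + P * derivative (derivative Q) = 0

theorem log_deriv_second {K : Type*} [Field K] {p q p' q' p'' q'' : K} (hp : p ≠ 0) (hq : q ≠ 0)
    (h : p'' * q - 2 * p' * q' + p * q'' = 0) (ψ'' : K)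
    (hψ : ψ'' = ((p'' * q - p * q'') * q ^ 2 - (p' * q - p * q') * (2 * q * q')) / (q ^ 2) ^ 2) :
    ψ'' / (p / q) = -2 * (q'' * q - q' ^ 2) / q ^ 2 := by
  rw [hψ]
  field_simp
  linear_combination q * h

theorem log_deriv_second_iff {K : Type*} [Field K] {p q p' q' p'' q'' : K} (hp : p ≠ 0) (hq : q ≠ 0)
    (ψ'' : K)
    (hψ : ψ'' = ((p'' * q - p * q'') * q ^ 2 - (p' * q - p * q') * (2 * q * q')) / (q ^ 2) ^ 2)
    (h : ψ'' / (p / q) = -2 * (q'' * q - q' ^ 2) / q ^ 2) :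
    p'' * q - 2 * p' * q' + p * q'' = 0 := by
  rw [hψ] at h
  field_simp at h
  apply mul_left_cancel₀ hq
  linear_combination h

theorem ratDeriv_ratDeriv_div (P : ℂ[X]) {Q : ℂ[X]} (hQ : Q ≠ 0) :
    ratDeriv (ratDeriv (algebraMap ℂ[X] (RatFunc ℂ) P / algebraMap ℂ[X] (RatFunc ℂ) Q)) =
      ((algebraMap ℂ[X] (RatFunc ℂ) (derivative (derivative P)) * algebraMap ℂ[X] (RatFunc ℂ) Q
        - algebraMap ℂ[X] (RatFunc ℂ) P * algebraMap ℂ[X] (RatFunc ℂ) (derivative (derivative Q)))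
        * algebraMap ℂ[X] (RatFunc ℂ) Q ^ 2
      - (algebraMap ℂ[X] (RatFunc ℂ) (derivative P) * algebraMap ℂ[X] (RatFunc ℂ) Q
        - algebraMap ℂ[X] (RatFunc ℂ) P * algebraMap ℂ[X] (RatFunc ℂ) (derivative Q))
        * (2 * algebraMap ℂ[X] (RatFunc ℂ) Q * algebraMap ℂ[X] (RatFunc ℂ) (derivative Q)))
      / (algebraMap ℂ[X] (RatFunc ℂ) Q ^ 2) ^ 2 := by
  have hQ' := RatFunc.algebraMap_ne_zero hQ
  rw [ratDeriv_div _ hQ', ratDeriv_div _ (pow_ne_zero 2 hQ')]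
  simp only [map_sub, Derivation.leibniz, smul_eq_mul, ratDeriv_algebraMap, sq]
  congr 1
  ring

/-- The right side is `-2 (ln Q)''` and does not involve `P`. Thus `P/Q` and `R/Q` solve the same
Schrödinger equation, which carries the Hirota equation over to the next pair. -/
theorem hirota_iff {P Q : ℂ[X]} (hP : P ≠ 0) (hQ : Q ≠ 0) :
    Hirota P Q ↔ ratDeriv (ratDeriv (algebraMap ℂ[X] (RatFunc ℂ) P / algebraMap ℂ[X] (RatFunc ℂ) Q))
      / (algebraMap ℂ[X] (RatFunc ℂ) P / algebraMap ℂ[X] (RatFunc ℂ) Q) =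
      -2 * (algebraMap ℂ[X] (RatFunc ℂ) (derivative (derivative Q)) * algebraMap ℂ[X] (RatFunc ℂ) Q
        - algebraMap ℂ[X] (RatFunc ℂ) (derivative Q) ^ 2) / algebraMap ℂ[X] (RatFunc ℂ) Q ^ 2 := by
  have hP' := RatFunc.algebraMap_ne_zero hP
  have hQ' := RatFunc.algebraMap_ne_zero hQ
  have e := ratDeriv_ratDeriv_div P hQ
  constructor
  · intro h
    refine log_deriv_second hP' hQ' ?_ _ e
    have := congrArg (algebraMap ℂ[X] (RatFunc ℂ)) h
    simpa only [map_mul, map_sub, map_add, map_ofNat, map_zero] using this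
  · intro h
    have := log_deriv_second_iff hP' hQ' _ e h
    apply RatFunc.algebraMap_injective ℂ
    simpa only [map_mul, map_sub, map_add, map_ofNat, map_zero] using this

theorem hirota_swap {P Q : ℂ[X]} (h : Hirota P Q) : Hirota Q P := by
  unfold Hirota at *
  linear_combination h

/-- The Bäcklund step: `Q_{n+1}` from `Q_{n-1}` and `Q_n`. -/
theorem exists_next {N n : ℕ} (hN : 1 ≤ N) {P Q : ℂ[X]} (hP : P.Monic) (hQ : Q.Monic)
    (hH : Hirota P Q) (hS : painleveII N (logDerivQuot P Q) n = 0) :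
    ∃ R : ℂ[X], R.Monic ∧ Hirota Q R ∧
      painleveII N (logDerivQuot Q R) ((n + 1 : ℕ) : ℂ) = 0 := by
  have hP' := RatFunc.algebraMap_ne_zero hP.ne_zero
  have hQ' := RatFunc.algebraMap_ne_zero hQ.ne_zero
  have hw := logDerivQuot_mem P Q
  have hM := mkdv_odd hw N
  rw [painleveII_eq] at hS
  have huL := lenard_mem_vanishAtInfty (neg_sub_sq_mem_vanishAtInfty hw) N
  have hH' := (hirota_iff hP.ne_zero hQ.ne_zero).mp hH
  set p := algebraMap ℂ[X] (RatFunc ℂ) P with hp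
  set q := algebraMap ℂ[X] (RatFunc ℂ) Q with hq
  set ψ := p / q with hψ
  have hψ0 : ψ ≠ 0 := div_ne_zero hP' hQ'
  set w := logDerivQuot P Q with hwdef
  have ew : w = ratDeriv ψ / ψ := rfl
  set u := -ratDeriv w - w ^ 2 with hu
  have eu : u = -(ratDeriv (ratDeriv ψ) / ψ) := by
    rw [hu, ew, ratDeriv_div _ hψ0]
    field_simp
    ring
  set L := lenard ratDeriv u N with hL
  have cn : RatFunc.C (n : ℂ) = (n : RatFunc ℂ) := map_natCast _ _
  set M := 2 * L - RatFunc.X with hMdef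
  -- Oddness enters here: it trades `L_N[w' - w²]` in the equation for `L_N[u]`.
  have hM2 : ratDeriv M - 2 * w * M = -(2 * n + 1) := by
    rw [hMdef, map_sub, Derivation.leibniz, ratDeriv_X, ratDeriv_two, smul_eq_mul, smul_zero]
    rw [cn] at hS
    linear_combination 2 * hM - 2 * hS
  set φ := -M / ψ with hφ
  have eM : M = -(φ * ψ) := by rw [hφ]; field_simp
  have hW : ratDeriv φ * ψ - φ * ratDeriv ψ = 2 * n + 1 := by
    rw [eM, map_neg, Derivation.leibniz, smul_eq_mul, smul_eq_mul, ew] at hM2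
    field_simp at hM2
    linear_combination -hM2
  have hc : (2 * n + 1 : RatFunc ℂ) ≠ 0 := by exact_mod_cast Nat.succ_ne_zero (2 * n)
  have hcC : RatFunc.C (2 * n + 1 : ℂ) = 2 * n + 1 := by
    rw [map_add, map_mul, map_ofNat, cn, map_one]
  have hφ0 : φ ≠ 0 := by
    intro h0
    rw [h0, map_zero, zero_mul, zero_mul, sub_zero] at hW
    exact hc hW.symm
  obtain ⟨R, hR⟩ := exists_polynomial_of_ratDeriv_div hP.ne_zero hQ.ne_zero hH
    (c := 2 * n + 1) (by exact_mod_cast Nat.succ_ne_zero (2 * n)) (F := φ * q) (by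
      have : φ * q / p = φ / ψ := by rw [hψ]; field_simp
      rw [← hp, this, ratDeriv_div _ hψ0, hW, ← hq, hψ, hcC]
      field_simp)
  have hR0 : R ≠ 0 := by
    rintro rfl
    rw [map_zero] at hR
    exact mul_ne_zero hφ0 hQ' hR.symm
  have eφ : algebraMap ℂ[X] (RatFunc ℂ) R / q = φ := by rw [hR, mul_div_cancel_right₀ _ hQ']
  have hφψ : ratDeriv (ratDeriv φ) / φ = ratDeriv (ratDeriv ψ) / ψ := by
    have h := congrArg ratDeriv hW
    have h1 : ratDeriv (2 * n + 1 : RatFunc ℂ) = 0 := by rw [← hcC, ratDeriv_C]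
    rw [h1, map_sub, Derivation.leibniz, Derivation.leibniz] at h
    simp only [smul_eq_mul] at h
    rw [div_eq_div_iff hφ0 hψ0]
    linear_combination h
  have hw1 : logDerivQuot Q R = -(ratDeriv φ / φ) := by
    have e : q / algebraMap ℂ[X] (RatFunc ℂ) R = 1 / φ := by rw [← eφ, one_div_div]
    rw [logDerivQuot, ← hq, e, ratDeriv_div _ hφ0, Derivation.map_one_eq_zero]
    field_simp
    ring
  refine ⟨R, ?_, ?_, ?_⟩
  -- Here `RP = φψQ² = -MQ² = (z - 2L)Q²` with `L` regular at infinity, so `zQ²` dominates.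
  · have e : R * P = X * Q ^ 2 + (R * P - X * Q ^ 2) := by ring
    refine hP.of_mul_monic_right ?_
    rw [e]
    refine Monic.add_of_left (monic_X.mul (hQ.pow 2)) ?_
    by_cases h0 : R * P - X * Q ^ 2 = 0
    · rw [h0, degree_zero]
      exact bot_lt_iff_ne_bot.mpr (degree_ne_bot.mpr
        (mul_ne_zero X_ne_zero (pow_ne_zero 2 hQ.ne_zero)))
    refine degree_lt_degree ?_
    have h1 : algebraMap ℂ[X] (RatFunc ℂ) (R * P - X * Q ^ 2) = -2 * L * q ^ 2 := by
      rw [map_sub, map_mul, map_mul, map_pow, hR, RatFunc.algebraMap_X, ← hp, ← hq]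
      have : φ * q * p = -M * q ^ 2 := by rw [hφ, hψ]; field_simp
      rw [this, hMdef]
      ring
    have h2 : algebraMap ℂ[X] (RatFunc ℂ) (R * P - X * Q ^ 2) ∈
        vanishAtInfty (-(2 * Q.natDegree : ℤ)) := by
      have m2 : (-2 : RatFunc ℂ) ∈ vanishAtInfty 0 := by
        have := C_mem_vanishAtInfty (-2)
        rwa [map_neg, map_ofNat] at this
      have mq : q ^ 2 ∈ vanishAtInfty (-(2 * Q.natDegree : ℤ)) := by
        rw [hq, ← map_pow, algebraMap_mem_vanishAtInfty (pow_ne_zero 2 hQ.ne_zero), natDegree_pow]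
        push_cast
        omega
      rw [h1]
      refine vanishAtInfty_anti ?_ (mul_mem_vanishAtInfty (mul_mem_vanishAtInfty m2 huL) mq)
      push_cast
      omega
    rw [algebraMap_mem_vanishAtInfty h0] at h2
    rw [(monic_X (R := ℂ)).natDegree_mul (hQ.pow 2), natDegree_X, natDegree_pow]
    omega
  · refine hirota_swap ((hirota_iff hR0 hQ.ne_zero).mpr ?_)
    rw [← hq, eφ, hφψ, hH']
  -- The new `w` is `-φ'/φ`, for which `w' - w² = -φ''/φ = u`. The same `L` therefore serves the
  -- next equation, which reduces to the Wronskian relation.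
  · have e1 : ratDeriv (logDerivQuot Q R) - logDerivQuot Q R ^ 2 = u := by
      rw [eu, ← hφψ, hw1, map_neg, ratDeriv_div _ hφ0]
      field_simp
      ring
    have e2 : RatFunc.C ((n + 1 : ℕ) : ℂ) = n + 1 := by simp
    have e3 : 2 * ratDeriv L = ratDeriv M + 1 := by
      rw [hMdef, map_sub, Derivation.leibniz, ratDeriv_X, ratDeriv_two, smul_eq_mul, smul_zero]
      ring
    rw [painleveII_eq, mkdv, e1, e2, ← hL]
    have e4 : 2 * L = M + RatFunc.X := by rw [hMdef]; ring
    have e5 : ratDeriv M = -(φ * ratDeriv ψ + ψ * ratDeriv φ) := by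
      rw [eM, map_neg, Derivation.leibniz, smul_eq_mul, smul_eq_mul]
    have e6 : ratDeriv φ / φ * M = -(ratDeriv φ * ψ) := by
      rw [eM]; field_simp
    have two : (2 : RatFunc ℂ) ≠ 0 := two_ne_zero
    apply mul_left_cancel₀ two
    rw [hw1]
    linear_combination e3 - 2 * (ratDeriv φ / φ) * e4 + e5 - 2 * e6 + hW

/-! ### Existence of the sequence -/

theorem logDerivQuot_one_X : logDerivQuot 1 X = -RatFunc.X⁻¹ := by
  have hX : (RatFunc.X : RatFunc ℂ) ≠ 0 := RatFunc.X_ne_zero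
  rw [logDerivQuot, map_one, RatFunc.algebraMap_X, ratDeriv_div _ hX, Derivation.map_one_eq_zero,
    ratDeriv_X]
  field_simp
  ring

/-- For `w = -1/z` one has `w' - w² = 0`, and `L_N[0] = 0` because `N ≥ 1`. -/
theorem painleveII_one {N : ℕ} (hN : 1 ≤ N) : painleveII N (logDerivQuot 1 X) ((1 : ℕ) : ℂ) = 0 := by
  have hX : (RatFunc.X : RatFunc ℂ) ≠ 0 := RatFunc.X_ne_zero
  obtain ⟨k, rfl⟩ := Nat.exists_eq_add_of_le' hN
  have e : ratDeriv (-RatFunc.X⁻¹) - (-RatFunc.X⁻¹) ^ 2 = 0 := by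
    rw [map_neg, inv_eq_one_div, ratDeriv_div _ hX, Derivation.map_one_eq_zero, ratDeriv_X]
    field_simp
    ring
  rw [painleveII_eq, mkdv, logDerivQuot_one_X, e, lenard_succ_zero]
  simp [hX]

theorem exists_isYablonskiiVorobev {N : ℕ} (hN : 1 ≤ N) : ∃ Q, IsYablonskiiVorobev N Q := by
  -- The recursion carries the pair `(Q_n, Q_{n+1})` together with its Hirota equation, which the
  -- Bäcklund step needs and reproduces.
  let T : ℕ → Type := fun n => {PQ : ℂ[X] × ℂ[X] // PQ.1.Monic ∧ PQ.2.Monic ∧ Hirota PQ.1 PQ.2 ∧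
    painleveII N (logDerivQuot PQ.1 PQ.2) ((n + 1 : ℕ) : ℂ) = 0}
  have hstep : ∀ n (s : T n), ∃ R : ℂ[X], R.Monic ∧ Hirota s.1.2 R ∧
      painleveII N (logDerivQuot s.1.2 R) ((n + 1 + 1 : ℕ) : ℂ) = 0 := fun n s =>
    exists_next hN s.2.1 s.2.2.1 s.2.2.2.1 s.2.2.2.2
  choose next h1 h2 h3 using hstep
  let s : ∀ n, T n := fun n => Nat.rec (motive := T)
    ⟨(1, X), monic_one, monic_X, by simp [Hirota], painleveII_one hN⟩
    (fun n s => ⟨(s.1.2, next n s), s.2.2.1, h1 n s, h2 n s, h3 n s⟩) n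
  have hs : ∀ n, (s (n + 1)).1.1 = (s n).1.2 := fun n => rfl
  refine ⟨fun n => (s n).1.1, fun n => (s n).2.1, rfl, rfl, fun n hn => ?_⟩
  obtain ⟨k, rfl⟩ := Nat.exists_eq_add_of_le' hn
  simp only [hs]
  exact (s k).2.2.2.2

/-! ### Uniqueness by contraction at infinity -/

/-- The equation of the hierarchy, solved for `w`, contracts towards `w = 0` at infinity. -/
theorem sub_mem_of_painleveII {v w F G : RatFunc ℂ} {α : ℂ} {k : ℤ}
    (hv : v = RatFunc.X⁻¹ * (F - RatFunc.C α)) (hw : w = RatFunc.X⁻¹ * (G - RatFunc.C α))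
    (h : F - G ∈ vanishAtInfty k) : v - w ∈ vanishAtInfty (k + 1) := by
  rw [hv, hw, ← mul_sub, sub_sub_sub_cancel_right, add_comm]
  exact mul_mem_vanishAtInfty inv_X_mem_vanishAtInfty h

theorem eq_of_painleveII {N : ℕ} {w : RatFunc ℂ} {α : ℂ} (h : painleveII N w α = 0) :
    w = RatFunc.X⁻¹ * (mkdv ratDeriv N w - RatFunc.C α) := by
  have hX : (RatFunc.X : RatFunc ℂ) ≠ 0 := RatFunc.X_ne_zero
  rw [painleveII_eq] at h
  rw [eq_inv_mul_iff_mul_eq₀ hX]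
  linear_combination -h

theorem painleveII_unique {N : ℕ} {v w : RatFunc ℂ} {α : ℂ} (mv : v ∈ vanishAtInfty 1)
    (mw : w ∈ vanishAtInfty 1) (hv : painleveII N v α = 0) (hw : painleveII N w α = 0) : v = w := by
  refine sub_eq_zero.mp (eq_zero_of_forall_mem_vanishAtInfty fun k => ?_)
  induction k with
  | zero => exact vanishAtInfty_anti (by norm_num) (sub_mem mv mw)
  | succ k ih =>
    push_cast
    exact sub_mem_of_painleveII (eq_of_painleveII hv) (eq_of_painleveII hw)
      (mkdv_sub_mem_vanishAtInfty mv mw ih N)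

theorem logDerivQuot_eq {P Q : ℂ[X]} (hP : P ≠ 0) (hQ : Q ≠ 0) : logDerivQuot P Q =
    algebraMap ℂ[X] (RatFunc ℂ) (derivative P) / algebraMap ℂ[X] (RatFunc ℂ) P
      - algebraMap ℂ[X] (RatFunc ℂ) (derivative Q) / algebraMap ℂ[X] (RatFunc ℂ) Q := by
  have hP' := RatFunc.algebraMap_ne_zero hP
  have hQ' := RatFunc.algebraMap_ne_zero hQ
  rw [logDerivQuot, ratDeriv_div _ hQ', ratDeriv_algebraMap, ratDeriv_algebraMap]
  field_simp

theorem eq_of_log_deriv_eq {P Q : ℂ[X]} (hP : P.Monic) (hQ : Q.Monic)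
    (h : algebraMap ℂ[X] (RatFunc ℂ) (derivative P) / algebraMap ℂ[X] (RatFunc ℂ) P =
      algebraMap ℂ[X] (RatFunc ℂ) (derivative Q) / algebraMap ℂ[X] (RatFunc ℂ) Q) : P = Q := by
  have hP' := RatFunc.algebraMap_ne_zero hP.ne_zero
  have hQ' := RatFunc.algebraMap_ne_zero hQ.ne_zero
  obtain ⟨c, hc⟩ := eq_C_of_ratDeriv_eq_zero
    (f := algebraMap ℂ[X] (RatFunc ℂ) P / algebraMap ℂ[X] (RatFunc ℂ) Q) (by
      rw [ratDeriv_div _ hQ', ratDeriv_algebraMap, ratDeriv_algebraMap]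
      rw [div_eq_div_iff hP' hQ'] at h
      rw [h, mul_comm, sub_self, zero_div])
  rw [div_eq_iff hQ', ← RatFunc.algebraMap_C, ← map_mul] at hc
  have e := RatFunc.algebraMap_injective ℂ hc
  have := congrArg leadingCoeff e
  rw [leadingCoeff_mul, leadingCoeff_C, hP.leadingCoeff, hQ.leadingCoeff, mul_one] at this
  rw [e, ← this, C_1, one_mul]

theorem IsYablonskiiVorobev.unique {N : ℕ} {Q Q' : ℕ → ℂ[X]} (h : IsYablonskiiVorobev N Q)
    (h' : IsYablonskiiVorobev N Q') : Q' = Q := by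
  funext n
  induction n with
  | zero => rw [h.zero, h'.zero]
  | succ n ih =>
    have s := h.solution (n + 1) (by omega)
    have s' := h'.solution (n + 1) (by omega)
    rw [Nat.add_sub_cancel] at s s'
    rw [ih] at s'
    have e := painleveII_unique (logDerivQuot_mem _ _) (logDerivQuot_mem _ _) s s'
    rw [logDerivQuot_eq (h.monic n).ne_zero (h.monic _).ne_zero,
      logDerivQuot_eq (h.monic n).ne_zero (h'.monic _).ne_zero] at e
    exact eq_of_log_deriv_eq (h'.monic _) (h.monic _) (sub_right_injective e).symm

/-! ### The formal solution, with `n` an indeterminate -/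

/-- The derivation `d/dz` on polynomials in `1/z` with coefficients in `ℂ[n]`. -/
noncomputable def bivDeriv : Derivation ℂ ℂ[X][X] ℂ[X][X] :=
  ((-X ^ 2 : ℂ[X][X]) • (Polynomial.derivative' : Derivation ℂ[X] ℂ[X][X] ℂ[X][X])).restrictScalars ℂ

theorem bivDeriv_apply (f : ℂ[X][X]) : bivDeriv f = -(X ^ 2 * derivative f) := by
  change -X ^ 2 * derivative f = _
  ring

theorem bivDeriv_C_mul_X_pow (a : ℂ[X]) (n : ℕ) :
    bivDeriv (C a * X ^ n) = C (-(n : ℂ[X]) * a) * X ^ (n + 1) := by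
  rw [bivDeriv_apply, derivative_C_mul_X_pow]
  cases n with
  | zero => simp
  | succ n =>
    simp only [C_mul, C_neg, Nat.add_sub_cancel, map_natCast]
    ring

theorem coeff_bivDeriv_zero (f : ℂ[X][X]) : (bivDeriv f).coeff 0 = 0 := by
  rw [bivDeriv_apply, coeff_neg, coeff_X_pow_mul', if_neg (by norm_num), neg_zero]

theorem coeff_bivDeriv_succ (f : ℂ[X][X]) (i : ℕ) :
    (bivDeriv f).coeff (i + 1) = -(i * f.coeff i) := by
  rw [bivDeriv_apply, coeff_neg, coeff_X_pow_mul']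
  cases i with
  | zero => simp
  | succ i =>
    rw [if_pos (by omega), show i + 1 + 1 - 2 = i by omega, coeff_derivative]
    push_cast
    ring

theorem bivDeriv_injective {f g : ℂ[X][X]} (h : bivDeriv f = bivDeriv g)
    (h0 : f.coeff 0 = g.coeff 0) : f = g := by
  ext1 i
  cases i with
  | zero => exact h0
  | succ i =>
    have := congrArg (coeff · (i + 2)) h
    simp only [coeff_bivDeriv_succ] at this
    have h1 : ((i + 1 : ℕ) : ℂ[X]) ≠ 0 := by exact_mod_cast Nat.succ_ne_zero i
    exact mul_left_cancel₀ h1 (neg_injective this)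

/-- Substitution of `1/z` for the variable. -/
noncomputable def evalInv : ℂ[X] →ₐ[ℂ] RatFunc ℂ := aeval (RatFunc.X⁻¹ : RatFunc ℂ)

theorem ratDeriv_inv_X : ratDeriv (RatFunc.X⁻¹ : RatFunc ℂ) = -(RatFunc.X⁻¹) ^ 2 := by
  have hX : (RatFunc.X : RatFunc ℂ) ≠ 0 := RatFunc.X_ne_zero
  rw [inv_eq_one_div, ratDeriv_div _ hX, Derivation.map_one_eq_zero, ratDeriv_X]
  field_simp
  ring

theorem evalInv_X : evalInv X = RatFunc.X⁻¹ := aeval_X _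

theorem evalInv_C (c : ℂ) : evalInv (C c) = RatFunc.C c := aeval_C _ _

theorem ratDeriv_evalInv (g : ℂ[X]) : ratDeriv (evalInv g) = evalInv (-(X ^ 2 * derivative g)) := by
  rw [map_neg, map_mul, map_pow, evalInv_X, evalInv, Derivation.map_aeval, ratDeriv_inv_X,
    smul_eq_mul]
  ring

theorem evalInv_mem (g : ℂ[X]) : evalInv g ∈ vanishAtInfty 0 := by
  induction g using Polynomial.induction_on' with
  | add p q hp hq => rw [map_add]; exact add_mem hp hq
  | monomial n a =>
    rw [← C_mul_X_pow_eq_monomial, map_mul, map_pow, evalInv_X, evalInv_C]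
    have h : RatFunc.X⁻¹ ∈ regularAtInfty :=
      vanishAtInfty_anti (k := 0) (by norm_num) inv_X_mem_vanishAtInfty
    exact regularAtInfty.mul_mem (C_mem_vanishAtInfty a) (pow_mem h n)

/-- This turns estimates in `ℂ(z)` back into identities between coefficients. Constant terms are
peeled off one at a time: a constant that vanishes at infinity is zero. -/
theorem X_pow_dvd_of_evalInv_mem {k : ℕ} {g : ℂ[X]} (h : evalInv g ∈ vanishAtInfty k) :
    X ^ k ∣ g := by
  induction k generalizing g with
  | zero => simp
  | succ k ih =>
    have hX : (RatFunc.X : RatFunc ℂ) ≠ 0 := RatFunc.X_ne_zero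
    have e := divX_mul_X_add g
    have e' := congrArg evalInv e
    rw [map_add, map_mul, evalInv_X, evalInv_C] at e'
    have h1 : RatFunc.C (g.coeff 0) ∈ vanishAtInfty 1 := by
      rw [eq_sub_of_add_eq' e']
      refine sub_mem (vanishAtInfty_anti (by push_cast; omega) h) ?_
      simpa using mul_mem_vanishAtInfty (evalInv_mem g.divX) inv_X_mem_vanishAtInfty
    have h2 := eq_zero_of_ratDeriv_eq_zero (ratDeriv_C _) h1
    rw [h2, add_zero] at e'
    rw [map_eq_zero] at h2
    rw [h2, C_0, add_zero] at e
    rw [← e, pow_succ]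
    refine mul_dvd_mul_right (ih ?_) X
    have : evalInv g.divX = RatFunc.X * evalInv g := by rw [← e']; field_simp
    rw [this]
    convert mul_mem_vanishAtInfty X_mem_vanishAtInfty h using 1
    push_cast
    ring_nf

/-- Specialization `n ↦ c` and substitution of `1/z`. -/
noncomputable def evalBiv (c : ℂ) : ℂ[X][X] →ₐ[ℂ] RatFunc ℂ :=
  evalInv.comp (mapAlgHom (aeval c))

theorem evalBiv_apply (c : ℂ) (f : ℂ[X][X]) : evalBiv c f = evalInv (f.map (evalRingHom c)) := rfl

theorem evalBiv_bivDeriv (c : ℂ) (f : ℂ[X][X]) :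
    evalBiv c (bivDeriv f) = ratDeriv (evalBiv c f) := by
  rw [evalBiv_apply, evalBiv_apply, ratDeriv_evalInv, bivDeriv_apply]
  simp only [Polynomial.map_mul, Polynomial.map_neg, Polynomial.map_pow, map_X, derivative_map]

/-- Successive approximations of the formal solution `w = (F(w) - n) / z` at infinity. -/
noncomputable def asympW (N : ℕ) : ℕ → ℂ[X][X]
  | 0 => 0
  | j + 1 => X * (mkdv bivDeriv N (asympW N j) - C X)

/-- The approximations of `z w`. -/
noncomputable def asympV (N j : ℕ) : ℂ[X][X] := mkdv bivDeriv N (asympW N j) - C X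

theorem asympW_succ (N j : ℕ) : asympW N (j + 1) = X * asympV N j := rfl

theorem evalBiv_asympW_mem (N j : ℕ) (c : ℂ) : evalBiv c (asympW N j) ∈ vanishAtInfty 1 := by
  cases j with
  | zero => exact Or.inl (map_zero _)
  | succ j =>
    rw [asympW_succ, map_mul, evalBiv_apply, map_X, evalInv_X]
    have := mul_mem_vanishAtInfty inv_X_mem_vanishAtInfty
      (evalInv_mem ((asympV N j).map (evalRingHom c)))
    rwa [add_zero] at this

/-- The start `0` is correct up to `O(1/z)`, and each iteration gains one order by the contraction
that proves uniqueness. -/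
theorem sub_evalBiv_asympW_mem {N : ℕ} {w : RatFunc ℂ} {c : ℂ} (mw : w ∈ vanishAtInfty 1)
    (hw : painleveII N w c = 0) (j : ℕ) :
    w - evalBiv c (asympW N j) ∈ vanishAtInfty ((j : ℤ) + 1) := by
  induction j with
  | zero => simpa [asympW] using mw
  | succ j ih =>
    have e : evalBiv c (asympW N (j + 1)) = RatFunc.X⁻¹ *
        (mkdv ratDeriv N (evalBiv c (asympW N j)) - RatFunc.C c) := by
      rw [asympW_succ, asympV, map_mul, map_sub,
        map_mkdv bivDeriv ratDeriv (evalBiv c) (evalBiv_bivDeriv c)]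
      congr 1
      · rw [evalBiv_apply, map_X, evalInv_X]
      · rw [evalBiv_apply c (C X), map_C, evalInv_C, coe_evalRingHom, eval_X]
    push_cast
    exact sub_mem_of_painleveII (eq_of_painleveII hw) e
      (mkdv_sub_mem_vanishAtInfty mw (evalBiv_asympW_mem N j c) ih N)

/-! ### Gap and leading term of the expansion -/

/-- The multiples of `X ^ e`. -/
noncomputable def xDivisible (e : ℕ) : AddSubgroup ℂ[X][X] :=
  (Ideal.span {(X : ℂ[X][X]) ^ e}).toAddSubgroup

theorem mem_xDivisible {e : ℕ} {f : ℂ[X][X]} : f ∈ xDivisible e ↔ X ^ e ∣ f :=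
  Ideal.mem_span_singleton

theorem bivDeriv_mem_xDivisible {e : ℕ} {f : ℂ[X][X]} (hf : f ∈ xDivisible e) :
    bivDeriv f ∈ xDivisible (e + 1) := by
  rw [mem_xDivisible, X_pow_dvd_iff] at *
  intro i hi
  cases i with
  | zero => exact coeff_bivDeriv_zero f
  | succ i => rw [coeff_bivDeriv_succ, hf i (by omega), mul_zero, neg_zero]

/-- Weight `2N + 1` is the reason for the gap: after the constant `-n`, the expansion of `zw`
resumes only at `z^{-2N-1}`. -/
theorem mkdv_mem_xDivisible {w : ℂ[X][X]} (hw : w ∈ xDivisible 1) (N : ℕ) :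
    mkdv bivDeriv N w ∈ xDivisible (2 * N + 1) := by
  refine mkdv_mem bivDeriv xDivisible (fun c => ?_) (fun i j a b ha hb => ?_)
    (fun i a => bivDeriv_mem_xDivisible) hw N
  · rw [mem_xDivisible, pow_zero]
    exact one_dvd _
  · rw [mem_xDivisible] at *
    rw [pow_add]
    exact mul_dvd_mul ha hb

theorem asympW_mem_xDivisible (N j : ℕ) : asympW N j ∈ xDivisible 1 := by
  cases j with
  | zero => exact zero_mem _
  | succ j =>
    rw [mem_xDivisible, pow_one]
    exact Dvd.intro _ rfl

theorem coeff_asympV_zero (N j : ℕ) : (asympV N j).coeff 0 = -X := by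
  have h := mkdv_mem_xDivisible (asympW_mem_xDivisible N j) N
  rw [mem_xDivisible, X_pow_dvd_iff] at h
  rw [asympV, coeff_sub, h 0 (by omega), coeff_C_zero, zero_sub]

theorem coeff_asympV_of_lt {N i : ℕ} (j : ℕ) (h0 : 0 < i) (hi : i < 2 * N + 1) :
    (asympV N j).coeff i = 0 := by
  have h := mkdv_mem_xDivisible (asympW_mem_xDivisible N j) N
  rw [mem_xDivisible, X_pow_dvd_iff] at h
  rw [asympV, coeff_sub, h i hi, coeff_C_of_ne_zero h0.ne', sub_zero]

/-- The coefficient of `L_k` on the leading term `-n/z`. -/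
noncomputable def lenardCoeff : ℕ → ℂ[X]
  | 0 => C (1 / 2)
  | k + 1 => C (2 * (2 * k + 1) / (k + 1) : ℂ) * (C (k * (k + 1) : ℂ) + X - X ^ 2) * lenardCoeff k

theorem natDegree_lenardCoeff (k : ℕ) :
    lenardCoeff k ≠ 0 ∧ (lenardCoeff k).natDegree = 2 * k := by
  induction k with
  | zero => simp [lenardCoeff]
  | succ k ih =>
    have hc : (2 * (2 * k + 1) / (k + 1) : ℂ) ≠ 0 := by
      refine div_ne_zero (mul_ne_zero two_ne_zero ?_) ?_
      · exact_mod_cast Nat.succ_ne_zero (2 * k)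
      · exact_mod_cast Nat.succ_ne_zero k
    have h2 : (C (k * (k + 1) : ℂ) + X - X ^ 2).natDegree = 2 := by compute_degree!
    have h3 : C (k * (k + 1) : ℂ) + X - X ^ 2 ≠ 0 := by
      intro h
      rw [h, natDegree_zero] at h2
      omega
    have h4 := mul_ne_zero (C_ne_zero.mpr hc) h3
    refine ⟨mul_ne_zero h4 ih.1, ?_⟩
    rw [lenardCoeff, natDegree_mul h4 ih.1, natDegree_C_mul hc, h2, ih.2]
    ring

/-- The argument `(n - n²)/z²` is `w' - w²` for `w = -n/z`. On such monomials the Lenard relation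
becomes the two-term recursion of `lenardCoeff`; the constant of integration is excluded by weight.
-/
theorem lenard_leading (k : ℕ) :
    lenard bivDeriv (C (X - X ^ 2) * X ^ 2) k = C (lenardCoeff k) * X ^ (2 * k) := by
  induction k with
  | zero =>
    rw [lenard_zero, lenardCoeff]
    simp
  | succ k ih =>
    refine bivDeriv_injective ?_ ?_
    · rw [lenard_recursion, ih]
      simp only [bivDeriv_C_mul_X_pow]
      have hk : C (k + 1 : ℂ) * C (2 * (2 * k + 1) / (k + 1) : ℂ) =
          C (2 * (2 * k + 1) : ℂ) := by
        rw [← C_mul, mul_div_cancel₀]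
        exact_mod_cast Nat.succ_ne_zero k
      have e : -((2 * (k + 1) : ℕ) : ℂ[X]) * lenardCoeff (k + 1) =
          -((2 * k + 1 + 1 : ℕ) : ℂ[X]) * (-((2 * k + 1 : ℕ) : ℂ[X]) * (-((2 * k : ℕ) : ℂ[X]) * lenardCoeff k))
          + 4 * (X - X ^ 2) * (-((2 * k : ℕ) : ℂ[X]) * lenardCoeff k)
          + 2 * (-((2 : ℕ) : ℂ[X]) * (X - X ^ 2)) * lenardCoeff k := by
        rw [lenardCoeff]
        simp only [map_add, map_mul, map_natCast, map_one, map_ofNat] at hk ⊢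
        push_cast
        linear_combination (-2 * ((k : ℂ[X]) * (k + 1) + X - X ^ 2) * lenardCoeff k) * hk
      rw [e]
      simp only [map_add, map_mul, map_ofNat]
      ring
    · have h := lenard_mem bivDeriv xDivisible (fun c => by
          rw [mem_xDivisible, pow_zero]; exact one_dvd _) (fun i j a b ha hb => by
          rw [mem_xDivisible] at *; rw [pow_add]; exact mul_dvd_mul ha hb)
        (fun i a => bivDeriv_mem_xDivisible) (u := C (X - X ^ 2) * X ^ 2)
        (mem_xDivisible.mpr (Dvd.intro_left _ rfl)) (k + 1)
      rw [mem_xDivisible, X_pow_dvd_iff] at h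
      rw [h 0 (by omega), coeff_C_mul_X_pow, if_neg (by omega)]

theorem mkdv_leading (N : ℕ) : mkdv bivDeriv N (C (-X) * X ^ 1) =
    C (-2 * ((N : ℂ[X]) + X) * lenardCoeff N) * X ^ (2 * N + 1) := by
  have e : bivDeriv (C (-X) * X ^ 1) - (C (-X) * X ^ 1) ^ 2 = C (X - X ^ 2) * X ^ 2 := by
    rw [bivDeriv_C_mul_X_pow]
    simp only [map_mul, map_neg, map_sub, map_pow, Nat.cast_one, map_one]
    ring
  rw [mkdv, e, lenard_leading, bivDeriv_C_mul_X_pow]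
  simp only [map_mul, map_neg, map_add, map_natCast, map_ofNat]
  push_cast
  ring

/-- From the first iterate on (hence `j + 1`), `w = -n/z` up to `O(z^{-2N-2})`. So the coefficient
is that of `mkdv_leading`, namely `-2(N + n)` times a polynomial of degree `2N`. -/
theorem natDegree_coeff_asympV (N j : ℕ) :
    ((asympV N (j + 1)).coeff (2 * N + 1)).natDegree = 2 * N + 1 := by
  have hW : asympW N (j + 1) - C (-X) * X ^ 1 ∈ xDivisible (2 * N + 2) := by
    have e : asympW N (j + 1) - C (-X) * X ^ 1 = X * mkdv bivDeriv N (asympW N j) := by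
      rw [asympW_succ, asympV, C_neg]
      ring
    have h := mkdv_mem_xDivisible (asympW_mem_xDivisible N j) N
    rw [e, mem_xDivisible, pow_succ']
    exact mul_dvd_mul_left X (mem_xDivisible.mp h)
  have h := mkdv_sub_mem bivDeriv ⊤ (xDivisible (2 * N + 2)) (fun _ => trivial) (fun _ _ => trivial)
    (fun a ha => by
      have := mem_xDivisible.mp (bivDeriv_mem_xDivisible ha)
      exact mem_xDivisible.mpr ((pow_dvd_pow X (by omega)).trans this))
    (fun a _ b hb => mem_xDivisible.mpr ((mem_xDivisible.mp hb).mul_left a))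
    (v := asympW N (j + 1)) (w := C (-X) * X ^ 1) trivial trivial hW N
  rw [mem_xDivisible, X_pow_dvd_iff] at h
  have h1 := h (2 * N + 1) (by omega)
  rw [coeff_sub, mkdv_leading, coeff_C_mul_X_pow, if_pos rfl, sub_eq_zero] at h1
  rw [asympV, coeff_sub, coeff_C_of_ne_zero (by omega), sub_zero, h1]
  have h2 : (-2 * ((N : ℂ[X]) + X)).natDegree = 1 := by
    have : (-2 * ((N : ℂ[X]) + X)) = C (-2 : ℂ) * (X + C (N : ℂ)) := by
      simp only [map_neg, map_ofNat, map_natCast]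
      ring
    rw [this, natDegree_C_mul (by norm_num), natDegree_X_add_C]
  have h3 : (-2 * ((N : ℂ[X]) + X)) ≠ 0 := by
    intro h
    rw [h, natDegree_zero] at h2
    omega
  rw [natDegree_mul h3 (natDegree_lenardCoeff N).1, h2, (natDegree_lenardCoeff N).2]
  ring

/-! ### Degree growth in `n` -/

/-- Polynomials in `1/z` whose coefficients have the degree growth of the formal solution. -/
noncomputable def degreeBounded (N e : ℕ) : AddSubgroup ℂ[X][X] where
  carrier := {f | ∀ i, (2 * N + 1) * (f.coeff i).natDegree ≤ e + 2 * N * i}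
  zero_mem' := by simp
  neg_mem' := by
    intro f hf i
    rw [coeff_neg, natDegree_neg]
    exact hf i
  add_mem' := by
    intro f g hf hg i
    rw [coeff_add]
    rcases le_max_iff.mp (natDegree_add_le (f.coeff i) (g.coeff i)) with h | h
    · exact (Nat.mul_le_mul_left _ h).trans (hf i)
    · exact (Nat.mul_le_mul_left _ h).trans (hg i)

theorem mul_natDegree_sum_le {ι : Type*} (s : Finset ι) (f : ι → ℂ[X]) {m b : ℕ}
    (h : ∀ i ∈ s, m * (f i).natDegree ≤ b) : m * (∑ i ∈ s, f i).natDegree ≤ b := by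
  refine Finset.sum_induction f (fun p => m * p.natDegree ≤ b) (fun p q hp hq => ?_) (by simp) h
  rcases le_max_iff.mp (natDegree_add_le p q) with h | h
  · exact (Nat.mul_le_mul_left _ h).trans hp
  · exact (Nat.mul_le_mul_left _ h).trans hq

/-- Give `n` weight `2N+1` and `z` weight `2N`. Then `w` has weight at most `1`, and `zw` and the
constant `n` both have weight at most `2N+1`, so the bound survives the iteration. -/
theorem mkdv_mem_degreeBounded {N : ℕ} {w : ℂ[X][X]} (hw : w ∈ degreeBounded N 1) :
    mkdv bivDeriv N w ∈ degreeBounded N (2 * N + 1) := by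
  refine mkdv_mem bivDeriv (degreeBounded N) (fun c i => ?_) (fun i j a b ha hb k => ?_)
    (fun i a ha k => ?_) hw N
  · have : (algebraMap ℂ ℂ[X][X] c) = C (C c) := rfl
    rw [this, coeff_C]
    split_ifs <;> simp
  · rw [coeff_mul]
    refine mul_natDegree_sum_le _ _ fun x hx => ?_
    rw [Finset.HasAntidiagonal.mem_antidiagonal] at hx
    have h1 := ha x.1
    have h2 := hb x.2
    have h3 := Nat.mul_le_mul_left (2 * N + 1) (natDegree_mul_le (p := a.coeff x.1) (q := b.coeff x.2))
    rw [mul_add] at h3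
    rw [← hx, mul_add]
    omega
  · cases k with
    | zero => rw [coeff_bivDeriv_zero]; simp
    | succ k =>
      have h1 := ha k
      have h2 : (-((k : ℂ[X]) * a.coeff k)).natDegree ≤ (a.coeff k).natDegree := by
        rw [natDegree_neg, ← C_eq_natCast]
        exact natDegree_C_mul_le _ _
      rw [coeff_bivDeriv_succ]
      have h3 := Nat.mul_le_mul_left (2 * N + 1) h2
      rw [mul_add]
      omega

theorem asympV_mem_degreeBounded_of {N j : ℕ} (h : asympW N j ∈ degreeBounded N 1) :
    asympV N j ∈ degreeBounded N (2 * N + 1) := by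
  refine sub_mem (mkdv_mem_degreeBounded h) fun i => ?_
  rw [coeff_C]
  split_ifs <;> simp

theorem asympW_mem_degreeBounded (N j : ℕ) : asympW N j ∈ degreeBounded N 1 := by
  induction j with
  | zero => exact zero_mem _
  | succ j ih =>
    intro i
    rw [asympW_succ]
    cases i with
    | zero => simp
    | succ i =>
      have := asympV_mem_degreeBounded_of ih i
      rw [coeff_X_mul, mul_add]
      omega

theorem asympV_mem_degreeBounded (N j : ℕ) : asympV N j ∈ degreeBounded N (2 * N + 1) :=
  asympV_mem_degreeBounded_of (asympW_mem_degreeBounded N j)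

/-! ### Summation over `n` -/

/-- Summation of polynomials: the sum is a polynomial of one degree more. -/
theorem exists_sum_polynomial (P : ℂ[X]) : ∃ B : ℂ[X],
    (∀ n : ℕ, B.eval (n : ℂ) = ∑ i ∈ Finset.range n, P.eval ((i + 1 : ℕ) : ℂ)) ∧
    ∀ d, P.natDegree ≤ d → B.natDegree ≤ d + 1 ∧ B.coeff (d + 1) * (d + 1) = P.coeff d := by
  suffices H : ∀ d (P : ℂ[X]), P.natDegree ≤ d → ∃ B : ℂ[X],
      (∀ n : ℕ, B.eval (n : ℂ) = ∑ i ∈ Finset.range n, P.eval ((i + 1 : ℕ) : ℂ)) ∧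
      B.natDegree ≤ d + 1 ∧ B.coeff (d + 1) * (d + 1) = P.coeff d by
    obtain ⟨B, h1, h2, h3⟩ := H _ P le_rfl
    refine ⟨B, h1, fun d hd => ?_⟩
    rcases hd.eq_or_lt with rfl | hlt
    · exact ⟨h2, h3⟩
    · exact ⟨by omega, by
        rw [coeff_eq_zero_of_natDegree_lt (by omega), coeff_eq_zero_of_natDegree_lt hlt, zero_mul]⟩
  intro d
  induction d with
  | zero =>
    intro P hP
    obtain ⟨c, rfl⟩ : ∃ c, P = C c := ⟨_, eq_C_of_natDegree_le_zero hP⟩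
    refine ⟨C c * X, fun n => ?_, (natDegree_C_mul_le _ _).trans natDegree_X_le, by simp⟩
    rw [eval_mul, eval_C, eval_X, mul_comm]
    simp only [eval_C, Finset.sum_const, Finset.card_range, nsmul_eq_mul]
  | succ d ih =>
    intro P hP
    -- The difference `T` below has leading term `(d+2) X^{d+1}` and telescopes to `n^{d+2}`;
    -- subtracting `aT` removes the top coefficient of `P`.
    set a : ℂ := P.coeff (d + 1) / (d + 2) with ha
    have hd : (d + 2 : ℂ) ≠ 0 := by exact_mod_cast (by omega : d + 2 ≠ 0)
    set T : ℂ[X] := X ^ (d + 2) - (X - 1) ^ (d + 2) with hT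
    have hTd : T.natDegree ≤ d + 1 ∧ T.coeff (d + 1) = d + 2 := by
      have e1 : (X - 1 : ℂ[X]) = X + C (-1) := by simp [sub_eq_add_neg]
      have hc : ∀ i, T.coeff i = (if i = d + 2 then 1 else 0) -
          (-1) ^ (d + 2 - i) * ((d + 2).choose i : ℂ) := by
        intro i
        rw [hT, coeff_sub, coeff_X_pow, e1, coeff_X_add_C_pow]
      refine ⟨natDegree_le_iff_coeff_eq_zero.mpr fun i hi => ?_, ?_⟩
      · rw [hc]
        rcases (show d + 2 ≤ i from hi).eq_or_lt with rfl | h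
        · simp
        · rw [if_neg (by omega), Nat.choose_eq_zero_of_lt h]
          simp
      · rw [hc, if_neg (by omega), show d + 2 - (d + 1) = 1 by omega,
          show d + 2 = (d + 1) + 1 by omega, Nat.choose_succ_self_right]
        push_cast
        ring
    have hP' : (P - C a * T).natDegree ≤ d := by
      refine natDegree_le_iff_coeff_eq_zero.mpr fun i hi => ?_
      rw [coeff_sub, coeff_C_mul]
      rcases (show d + 1 ≤ i from hi).eq_or_lt with rfl | h
      · rw [hTd.2, ha, div_mul_cancel₀ _ hd, sub_self]
      · rw [coeff_eq_zero_of_natDegree_lt (by omega), coeff_eq_zero_of_natDegree_lt (by omega)]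
        simp
    obtain ⟨B, h1, h2, h3⟩ := ih _ hP'
    refine ⟨B + C a * X ^ (d + 2), fun n => ?_, ?_, ?_⟩
    · have hsum : ∑ i ∈ Finset.range n, T.eval ((i + 1 : ℕ) : ℂ) = (n : ℂ) ^ (d + 2) := by
        induction n with
        | zero => simp
        | succ n ihn =>
          rw [Finset.sum_range_succ, ihn, hT]
          simp
      rw [eval_add, h1, eval_mul, eval_C, eval_pow, eval_X, ← hsum, Finset.mul_sum,
        ← Finset.sum_add_distrib]
      refine Finset.sum_congr rfl fun i _ => ?_
      rw [eval_sub, eval_mul, eval_C]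
      ring
    · exact natDegree_add_le_of_degree_le (by omega) (natDegree_C_mul_X_pow_le _ _)
    · rw [coeff_add, coeff_C_mul_X_pow, if_pos rfl, coeff_eq_zero_of_natDegree_lt (by omega), ha]
      push_cast
      field_simp
      ring

/-- The polynomial `B` with `B(n) = P(1) + ⋯ + P(n)`. -/
noncomputable def sumPolynomial (P : ℂ[X]) : ℂ[X] := (exists_sum_polynomial P).choose

theorem eval_sumPolynomial (P : ℂ[X]) (n : ℕ) : (sumPolynomial P).eval (n : ℂ) =
    ∑ i ∈ Finset.range n, P.eval ((i + 1 : ℕ) : ℂ) := (exists_sum_polynomial P).choose_spec.1 n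

theorem natDegree_sumPolynomial (P : ℂ[X]) {d : ℕ} (h : P.natDegree ≤ d) :
    (sumPolynomial P).natDegree ≤ d + 1 := ((exists_sum_polynomial P).choose_spec.2 d h).1

theorem coeff_sumPolynomial (P : ℂ[X]) {d : ℕ} (h : P.natDegree ≤ d) :
    (sumPolynomial P).coeff (d + 1) * (d + 1) = P.coeff d :=
  ((exists_sum_polynomial P).choose_spec.2 d h).2

/-- `sumPolynomial` comes from a choice, so it is identified by its values at infinitely many
points. -/
theorem sumPolynomial_zero : sumPolynomial 0 = 0 := by
  refine Polynomial.eq_of_infinite_eval_eq _ _ (Set.infinite_of_injective_forall_mem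
    (f := fun n : ℕ => (n : ℂ)) Nat.cast_injective fun n => ?_)
  simp [eval_sumPolynomial]

/-! ### Logarithmic derivatives of the polynomials -/

/-- The approximations of `z Q_n' / Q_n`. -/
noncomputable def asympS (N j : ℕ) : ℂ[X][X] :=
  ∑ i ∈ Finset.range ((asympV N j).natDegree + 1),
    monomial i (sumPolynomial (-(asympV N j).coeff i))

theorem coeff_asympS (N j i : ℕ) :
    (asympS N j).coeff i = sumPolynomial (-(asympV N j).coeff i) := by
  rw [asympS, finsetSum_coeff]
  simp only [coeff_monomial]
  rw [Finset.sum_ite_eq' (Finset.range ((asympV N j).natDegree + 1)) i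
    (fun i => sumPolynomial (-(asympV N j).coeff i))]
  split_ifs with h
  · rfl
  · rw [Finset.mem_range, not_lt] at h
    rw [coeff_eq_zero_of_natDegree_lt (by omega), neg_zero, sumPolynomial_zero]

theorem map_asympS_succ (N j n : ℕ) :
    (asympS N j).map (evalRingHom ((n + 1 : ℕ) : ℂ)) =
      (asympS N j).map (evalRingHom (n : ℂ)) - (asympV N j).map (evalRingHom ((n + 1 : ℕ) : ℂ)) := by
  ext i
  rw [coeff_sub, coeff_map, coeff_map, coeff_map, coeff_asympS]
  simp only [coe_evalRingHom]
  rw [eval_sumPolynomial, eval_sumPolynomial, Finset.sum_range_succ, eval_neg]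
  ring

theorem map_asympS_zero (N j : ℕ) : (asympS N j).map (evalRingHom 0) = 0 := by
  ext i
  rw [coeff_map, coeff_asympS, coe_evalRingHom]
  simpa using eval_sumPolynomial (-(asympV N j).coeff i) 0

theorem IsYablonskiiVorobev.X_mul_log_deriv_sub_mem {N : ℕ} {Q : ℕ → ℂ[X]}
    (h : IsYablonskiiVorobev N Q) (j n : ℕ) :
    RatFunc.X * (algebraMap ℂ[X] (RatFunc ℂ) (derivative (Q n)) / algebraMap ℂ[X] (RatFunc ℂ) (Q n))
      - evalBiv n (asympS N j) ∈ vanishAtInfty ((j : ℤ) + 1) := by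
  have hX : (RatFunc.X : RatFunc ℂ) ≠ 0 := RatFunc.X_ne_zero
  induction n with
  | zero =>
    rw [h.zero, evalBiv_apply, Nat.cast_zero, map_asympS_zero]
    simp
  | succ n ih =>
    have hs := h.solution (n + 1) (by omega)
    rw [Nat.add_sub_cancel] at hs
    -- Index `j + 1`, because the multiplication by `z` that follows costs one order.
    have h1 := sub_evalBiv_asympW_mem (logDerivQuot_mem _ _) hs (j + 1)
    have h2 := sub_mem ih (vanishAtInfty_anti (k := (j : ℤ) + 1) (by push_cast; omega)
      (mul_mem_vanishAtInfty X_mem_vanishAtInfty h1))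
    convert h2 using 1
    rw [logDerivQuot_eq (h.monic n).ne_zero (h.monic (n + 1)).ne_zero, asympW_succ, map_mul,
      evalBiv_apply _ X, map_X, evalInv_X, evalBiv_apply, evalBiv_apply, evalBiv_apply,
      map_asympS_succ, map_sub]
    field_simp
    ring

theorem algebraMap_eq_X_pow_mul_evalInv (Q : ℂ[X]) : algebraMap ℂ[X] (RatFunc ℂ) Q =
    RatFunc.X ^ Q.natDegree * evalInv (reflect Q.natDegree Q) := by
  let _ : Invertible (RatFunc.X : RatFunc ℂ) := invertibleOfNonzero RatFunc.X_ne_zero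
  have h := eval₂_reflect_mul_pow (algebraMap ℂ (RatFunc ℂ)) RatFunc.X Q.natDegree Q le_rfl
  rw [invOf_eq_inv] at h
  rw [mul_comm]
  refine Eq.trans ?_ h.symm
  rw [← aeval_def, ← RatFunc.algebraMap_X, aeval_algebraMap_apply, aeval_X_left_apply]

/-- With `Q = z^p q(1/z)` and `t = 1/z`, one has `z d/dz = -t d/dt`. -/
theorem X_mul_log_deriv {Q : ℂ[X]} (hQ : Q ≠ 0) :
    RatFunc.X * (algebraMap ℂ[X] (RatFunc ℂ) (derivative Q) / algebraMap ℂ[X] (RatFunc ℂ) Q)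
      * evalInv (reflect Q.natDegree Q) =
    evalInv (C (Q.natDegree : ℂ) * reflect Q.natDegree Q
      - X * derivative (reflect Q.natDegree Q)) := by
  have hX : (RatFunc.X : RatFunc ℂ) ≠ 0 := RatFunc.X_ne_zero
  have e := algebraMap_eq_X_pow_mul_evalInv Q
  have hQ' := RatFunc.algebraMap_ne_zero hQ
  rw [← ratDeriv_algebraMap]
  rw [e] at hQ' ⊢
  set q := reflect Q.natDegree Q
  have hq : evalInv q ≠ 0 := fun h0 => hQ' (by rw [h0, mul_zero])
  have hp : RatFunc.X * ratDeriv (RatFunc.X ^ Q.natDegree) =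
      (Q.natDegree : RatFunc ℂ) * RatFunc.X ^ Q.natDegree := by
    rw [Derivation.leibniz_pow, ratDeriv_X]
    cases Q.natDegree with
    | zero => rw [zero_smul, mul_zero, Nat.cast_zero, zero_mul]
    | succ k =>
      rw [Nat.add_sub_cancel, nsmul_eq_mul, smul_eq_mul, pow_succ]
      ring
  rw [Derivation.leibniz, smul_eq_mul, smul_eq_mul, ratDeriv_evalInv, map_neg, map_mul, map_pow,
    evalInv_X, map_sub, map_mul, map_mul, evalInv_X, evalInv_C, map_natCast]
  have : RatFunc.X * ((RatFunc.X ^ Q.natDegree * -(RatFunc.X⁻¹ ^ 2 * evalInv (derivative q)) +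
      evalInv q * ratDeriv (RatFunc.X ^ Q.natDegree)) /
        (RatFunc.X ^ Q.natDegree * evalInv q)) * evalInv q =
      (RatFunc.X ^ Q.natDegree * -(RatFunc.X * (RatFunc.X⁻¹ ^ 2 * evalInv (derivative q))) +
      evalInv q * (RatFunc.X * ratDeriv (RatFunc.X ^ Q.natDegree))) / RatFunc.X ^ Q.natDegree := by
    field_simp
  rw [this, hp]
  field_simp
  ring

/-- This is the coefficient of `z^{-k}` in `z Q' = Q · (z Q'/Q)`. The approximation of the last
factor is exact through `z^{-j}`, whence `k ≤ j`. -/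
theorem IsYablonskiiVorobev.coeff_reflect_relation {N : ℕ} {Q : ℕ → ℂ[X]}
    (h : IsYablonskiiVorobev N Q) (n : ℕ) {j k : ℕ} (hk : k ≤ j) :
    ((Q n).natDegree - k : ℂ) * (reflect (Q n).natDegree (Q n)).coeff k =
      ∑ x ∈ Finset.HasAntidiagonal.antidiagonal k, (reflect (Q n).natDegree (Q n)).coeff x.1 *
        ((asympS N j).coeff x.2).eval (n : ℂ) := by
  have h1 := mul_mem_vanishAtInfty (h.X_mul_log_deriv_sub_mem j n)
    (evalInv_mem (reflect (Q n).natDegree (Q n)))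
  rw [sub_mul, X_mul_log_deriv (h.monic n).ne_zero, evalBiv_apply, ← map_mul, ← map_sub,
    add_zero] at h1
  have h2 := X_pow_dvd_of_evalInv_mem (k := j + 1) (by push_cast; exact h1)
  rw [X_pow_dvd_iff] at h2
  have h3 := h2 k (by omega)
  rw [coeff_sub, coeff_sub, coeff_C_mul, 
    mul_comm (map _ _), coeff_mul (reflect _ _)] at h3
  simp only [coeff_map, coe_evalRingHom] at h3
  have h4 : (X * derivative (reflect (Q n).natDegree (Q n))).coeff k =
      k * (reflect (Q n).natDegree (Q n)).coeff k := by
    cases k with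
    | zero => simp
    | succ k =>
      rw [coeff_X_mul, coeff_derivative]
      push_cast
      ring
  rw [h4] at h3
  linear_combination h3

theorem coeff_reflect_natDegree_zero {Q : ℂ[X]} (hQ : Q.Monic) :
    (reflect Q.natDegree Q).coeff 0 = 1 := by
  rw [coeff_reflect, revAt_le (Nat.zero_le _), Nat.sub_zero]
  exact hQ

theorem IsYablonskiiVorobev.natDegree_eq_eval {N : ℕ} {Q : ℕ → ℂ[X]}
    (h : IsYablonskiiVorobev N Q) (j n : ℕ) :
    ((Q n).natDegree : ℂ) = ((asympS N j).coeff 0).eval (n : ℂ) := by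
  have := h.coeff_reflect_relation n (Nat.zero_le j)
  rwa [Finset.HasAntidiagonal.antidiagonal_zero, Finset.sum_singleton,
    coeff_reflect_natDegree_zero (h.monic n), one_mul, mul_one, Nat.cast_zero, sub_zero] at this

theorem IsYablonskiiVorobev.natDegree_eq {N : ℕ} {Q : ℕ → ℂ[X]}
    (h : IsYablonskiiVorobev N Q) (n : ℕ) : (Q n).natDegree * 2 = n * (n + 1) := by
  have h1 := h.natDegree_eq_eval 0 n
  rw [coeff_asympS, coeff_asympV_zero, neg_neg, eval_sumPolynomial] at h1
  simp only [eval_X] at h1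
  have h2 : (Q n).natDegree = ∑ i ∈ Finset.range n, (i + 1) := by exact_mod_cast h1
  have h3 := Finset.sum_range_succ' (fun i => i) n
  have h4 := Finset.sum_range_id_mul_two (n + 1)
  rw [h2, mul_comm n]
  simp only [add_zero] at h3
  rw [← h3]
  exact h4

/-! ### The coefficients as polynomials in `n`: degree and roots -/

/-- The coefficient `A_{n,k}` as a polynomial in `n`. -/
noncomputable def coeffPoly (N j : ℕ) : ℕ → ℂ[X]
  | 0 => 1
  | k + 1 => C (-1 / (k + 1) : ℂ) *
      ∑ i : Fin (k + 1), coeffPoly N j i * (asympS N j).coeff (k + 1 - i)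
  decreasing_by exact i.2

theorem coeffPoly_succ (N j k : ℕ) : coeffPoly N j (k + 1) = C (-1 / (k + 1) : ℂ) *
    ∑ i ∈ Finset.range (k + 1), coeffPoly N j i * (asympS N j).coeff (k + 1 - i) := by
  rw [coeffPoly, Fin.sum_univ_eq_sum_range
    (fun i => coeffPoly N j i * (asympS N j).coeff (k + 1 - i))]

theorem IsYablonskiiVorobev.coeff_reflect_eq {N : ℕ} {Q : ℕ → ℂ[X]}
    (h : IsYablonskiiVorobev N Q) (n : ℕ) {j k : ℕ} (hk : k ≤ j) :
    (reflect (Q n).natDegree (Q n)).coeff k = (coeffPoly N j k).eval (n : ℂ) := by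
  induction k using Nat.strong_induction_on with
  | _ k ih =>
    cases k with
    | zero => rw [coeff_reflect_natDegree_zero (h.monic n), coeffPoly, eval_one]
    | succ k =>
      have e := h.coeff_reflect_relation n hk
      rw [Finset.Nat.sum_antidiagonal_eq_sum_range_succ_mk, Finset.sum_range_succ, Nat.sub_self,
        -- The term with `s_0(n) = deg Q_n` cancels against the left side and leaves `-(k+1)
        -- A_{k+1}`.
        ← h.natDegree_eq_eval] at e
      rw [coeffPoly_succ, eval_mul, eval_C, eval_finsetSum]
      have e2 : ∑ i ∈ Finset.range (k + 1), (coeffPoly N j i * (asympS N j).coeff (k + 1 - i)).eval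
          (n : ℂ) = ∑ i ∈ Finset.range (k + 1), (reflect (Q n).natDegree (Q n)).coeff i *
            ((asympS N j).coeff (k + 1 - i)).eval (n : ℂ) := by
        refine Finset.sum_congr rfl fun i hi => ?_
        rw [Finset.mem_range] at hi
        rw [eval_mul, ih i hi (by omega)]
      rw [e2]
      have hk0 : (k + 1 : ℂ) ≠ 0 := by exact_mod_cast Nat.succ_ne_zero k
      push_cast at e
      field_simp
      linear_combination -e

theorem coeff_asympS_of_lt {N i : ℕ} (j : ℕ) (h0 : 0 < i) (hi : i < 2 * N + 1) :
    (asympS N j).coeff i = 0 := by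
  rw [coeff_asympS, coeff_asympV_of_lt j h0 hi, neg_zero, sumPolynomial_zero]

theorem natDegree_coeff_asympS_le (N j i : ℕ) :
    (2 * N + 1) * ((asympS N j).coeff i).natDegree ≤ 2 * (2 * N + 1) + 2 * N * i := by
  have h1 := asympV_mem_degreeBounded N j i
  have h2 := natDegree_sumPolynomial (-(asympV N j).coeff i) (natDegree_neg _).le
  rw [coeff_asympS]
  have h3 := Nat.mul_le_mul_left (2 * N + 1) h2
  rw [mul_add, mul_one] at h3
  omega

theorem coeff_asympS_leading (N j : ℕ) :
    ((asympS N (j + 1)).coeff (2 * N + 1)).natDegree ≤ 2 * N + 2 ∧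
      ((asympS N (j + 1)).coeff (2 * N + 1)).coeff (2 * N + 2) ≠ 0 := by
  have h := natDegree_coeff_asympV N j
  have h1 : (-(asympV N (j + 1)).coeff (2 * N + 1)).natDegree = 2 * N + 1 := by rw [natDegree_neg, h]
  rw [coeff_asympS]
  refine ⟨natDegree_sumPolynomial _ h1.le, fun h0 => ?_⟩
  have h2 := coeff_sumPolynomial _ h1.le
  rw [h0, zero_mul] at h2
  have h3 : (-(asympV N (j + 1)).coeff (2 * N + 1)).leadingCoeff = 0 := by
    rw [leadingCoeff, h1]
    exact h2.symm
  rw [leadingCoeff_eq_zero] at h3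
  rw [h3, natDegree_zero] at h1
  omega

/-- For `m = k - i ≥ 2N+1` one has `2(2N+1) + 2Nm ≤ (2N+2)m`; smaller `m > 0` contribute nothing. -/
theorem natDegree_coeffPoly_mul_le (N j k : ℕ) :
    (2 * N + 1) * (coeffPoly N j k).natDegree ≤ (2 * N + 2) * k := by
  induction k using Nat.strong_induction_on with
  | _ k ih =>
    cases k with
    | zero => simp [coeffPoly]
    | succ k =>
      rw [coeffPoly_succ]
      refine (Nat.mul_le_mul_left _ (natDegree_C_mul_le _ _)).trans
        (mul_natDegree_sum_le _ _ fun i hi => ?_)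
      rw [Finset.mem_range] at hi
      by_cases hlt : k + 1 - i < 2 * N + 1
      · rw [coeff_asympS_of_lt j (by omega) hlt]
        simp
      · have h1 := ih i hi
        have h2 := natDegree_coeff_asympS_le N j (k + 1 - i)
        have h3 := Nat.mul_le_mul_left (2 * N + 1)
          (natDegree_mul_le (p := coeffPoly N j i) (q := (asympS N j).coeff (k + 1 - i)))
        obtain ⟨r, hr⟩ := Nat.exists_eq_add_of_le (not_lt.mp hlt)
        have e : k + 1 = i + (2 * N + 1 + r) := by omega
        rw [hr] at h2 h3 ⊢
        rw [e]
        nlinarith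

/-- Equality in the preceding estimate forces `m = 2N+1`, so a single summand reaches the top degree
and no cancellation can occur. -/
theorem coeffPoly_leading (N j l : ℕ) :
    (coeffPoly N (j + 1) ((2 * N + 1) * l)).coeff ((2 * N + 2) * l) ≠ 0 := by
  induction l with
  | zero => simp [coeffPoly]
  | succ l ih =>
    obtain ⟨s1, s2⟩ := coeff_asympS_leading N j
    have e : (2 * N + 1) * (l + 1) = (2 * N + 1) * l + 2 * N + 1 := by ring
    rw [e, coeffPoly_succ, coeff_C_mul]
    refine mul_ne_zero (div_ne_zero (by norm_num)
      (by exact_mod_cast Nat.succ_ne_zero ((2 * N + 1) * l + 2 * N))) ?_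
    rw [finsetSum_coeff, Finset.sum_eq_single_of_mem ((2 * N + 1) * l)
      (Finset.mem_range.mpr (by omega))]
    · have e2 : (2 * N + 1) * l + 2 * N + 1 - (2 * N + 1) * l = 2 * N + 1 := by omega
      have hA : (coeffPoly N (j + 1) ((2 * N + 1) * l)).natDegree ≤ (2 * N + 2) * l := by
        have := natDegree_coeffPoly_mul_le N (j + 1) ((2 * N + 1) * l)
        rw [mul_left_comm] at this
        exact Nat.le_of_mul_le_mul_left this (by omega)
      rw [e2, mul_add, mul_one, coeff_mul_add_eq_of_natDegree_le hA s1]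
      exact mul_ne_zero ih s2
    · intro i hi hne
      rw [Finset.mem_range] at hi
      rcases lt_or_gt_of_ne hne with hlt | hgt
      · refine coeff_eq_zero_of_natDegree_lt ?_
        obtain ⟨r, hr⟩ := Nat.exists_eq_add_of_lt hlt
        have e2 : (2 * N + 1) * l + 2 * N + 1 - i = 2 * N + 1 + (r + 1) := by omega
        have h1 := natDegree_coeffPoly_mul_le N (j + 1) i
        have h2 := natDegree_coeff_asympS_le N (j + 1) (2 * N + 1 + (r + 1))
        rw [e2]
        have h3 := Nat.mul_le_mul_left (2 * N + 1) (natDegree_mul_le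
          (p := coeffPoly N (j + 1) i) (q := (asympS N (j + 1)).coeff (2 * N + 1 + (r + 1))))
        refine Nat.lt_of_mul_lt_mul_left (a := 2 * N + 1) (h3.trans_lt ?_)
        have e3 : (2 * N + 1) * ((2 * N + 2) * (l + 1)) =
          (2 * N + 2) * ((2 * N + 1) * l) + (2 * N + 1) * (2 * N + 2) := by ring
        rw [e3, hr]
        nlinarith
      · rw [coeff_asympS_of_lt (j + 1) (by omega) (by omega), mul_zero, coeff_zero]

theorem natDegree_coeffPoly (N j l : ℕ) :
    (coeffPoly N (j + 1) ((2 * N + 1) * l)).natDegree = 2 * (N + 1) * l := by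
  have := natDegree_coeffPoly_mul_le N (j + 1) ((2 * N + 1) * l)
  rw [mul_left_comm] at this
  have h1 := Nat.le_of_mul_le_mul_left this (by omega)
  have h2 := le_natDegree_of_ne_zero (coeffPoly_leading N j l)
  rw [le_antisymm h1 h2]
  ring

/-- The condition is `(n + 1/2)² < 1/4 + 2(2N+1)l`, expanded. -/
theorem lt_of_lt_nZero {N l n : ℕ} (h : n < nZero N l) : n * (n + 1) < 2 * ((2 * N + 1) * l) := by
  rw [nZero, Nat.lt_ceil, lt_sub_iff_add_lt] at h
  have h1 := (Real.lt_sqrt (by positivity)).mp h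
  have h2 : (n * (n + 1) : ℝ) < 2 * ((2 * N + 1) * l) := by linarith
  exact_mod_cast h2

theorem polyT_dvd {m : ℕ} {P : ℂ[X]} (h : ∀ n < m, P.eval (n : ℂ) = 0) : polyT m ∣ P := by
  refine Finset.prod_dvd_of_coprime (fun i _ j _ hij => ?_) fun i hi => ?_
  · exact pairwise_coprime_X_sub_C (s := fun i : ℕ => (i : ℂ)) Nat.cast_injective hij
  · exact dvd_iff_isRoot.mpr (h i (Finset.mem_range.mp hi))

end PainleveII
open PainleveII in
theorem theorem5 (N : ℕ) (hN : 1 ≤ N) :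
    ∃ Q : ℕ → ℂ[X], IsYablonskiiVorobev N Q ∧
      (∀ Q' : ℕ → ℂ[X], IsYablonskiiVorobev N Q' → Q' = Q) ∧
      ∀ l : ℕ, ∃ P : ℂ[X],
        (∀ n : ℕ, (2 * N + 1) * l ≤ (Q n).natDegree →
          coeffA (Q n) ((2 * N + 1) * l) = P.eval (n : ℂ)) ∧
        P.natDegree = 2 * (N + 1) * l ∧
        polyT (nZero N l) ∣ P := by
  obtain ⟨Q, hQ⟩ := exists_isYablonskiiVorobev hN
  refine ⟨Q, hQ, fun Q' hQ' => hQ.unique hQ', fun l => ?_⟩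
  -- The approximation must reach order `(2N+1)l`; the extra `1` ensures that it contains the
  -- leading term also for `l = 0`.
  refine ⟨coeffPoly N ((2 * N + 1) * l + 1) ((2 * N + 1) * l), fun n hn => ?_,
    natDegree_coeffPoly N _ l, polyT_dvd fun n hn => ?_⟩
  · rw [← hQ.coeff_reflect_eq n (Nat.le_succ _), coeff_reflect, revAt_le hn, coeffA]
  · have h1 := lt_of_lt_nZero hn
    have h2 := hQ.natDegree_eq n
    have h3 : (Q n).natDegree < (2 * N + 1) * l := by omega
    -- Reversal fixes indices above the degree, so the coefficient is one of `Q n` beyond its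
    -- degree.
    rw [← hQ.coeff_reflect_eq n (Nat.le_succ _), coeff_reflect, revAt_eq_self_of_lt h3,
      coeff_eq_zero_of_natDegree_lt h3]
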